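/- Let $k$ be a field. All quivers below are finite, $kQ$ denotes the path algebra of $Q$ (paths are composed like maps, so in $\alpha\beta$ the arrow $\beta$ comes first), and algebras are considered up to isomorphism of $k$-algebras. Trivial extension. For a finite-dimensional $k$-algebra $A$ let $DA=\operatorname{Hom}_k(A,k)$ be the $A$-$A$-bimodule with $(afb)(x)=f(bxa)$. The trivial extension $T(A)$ is the vector space $A\oplus DA$ with the multiplication $(a,f)(b,g)=(ab,\,ag+fb)$. Pedigrees. Consider the infinite rooted binary tree with root $\omega$ in which every point $x$ has two children $x'$ and $x''$, made into a quiver by arrows $\beta_x\colon x'\to x$ and $\alpha_x\colon x\to x''$. A pedigree $L$ is a finite subtree (with the arrows between its points) containing $\omega$. The pedigree algebra $A_L$ is the quotient of $kL$ by the ideal generated by all the paths $\alpha_x\beta_x$ for which $x',x,x''$ belong to $L$. Brauer-quivers. A cycle of length $n\ge 1$ in a quiver is a closed path of length $n$ leading through $n$ distinct points, considered up to the choice of its starting point. A Brauer-quiver is a finite, non-empty, connected quiver $Q$ such that each arrow occurs in a cycle, each point belongs to exactly two cycles, and any two different cycles have at most one point in common. For a point $x$ on a cycle $Z$ let $\zeta(x,Z)$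 be the path running once through $Z$ from $x$ to $x$. The Brauer-quiver algebra $B(Q)$ is the quotient of $kQ$ by the ideal generated by all paths of length two that do not lie on a cycle (a path of length two lies on a cycle if both of its arrows occur in that cycle) and by the elements $\zeta(x,Z)-\zeta(x,Z')$, where $x$ is a point and $Z,Z'$ are the two cycles containing $x$. Theorem. (a) For every pedigree $L$ there is a Brauer-quiver $Q$ such that the $k$-algebras $T(A_L)$ and $B(Q)$ are isomorphic. (b) For every Brauer-quiver $Q$ there is a pedigree $L$ such that the $k$-algebras $B(Q)$ and $T(A_L)$ are isomorphic. -/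

import Mathlib

universe u v w

noncomputable section

/-! ### Path algebras -/

/-- Generators of the path algebra of a quiver: a trivial path for each point, and the arrows. -/
inductive PathGen (V : Type u) [Quiver.{v} V] : Type (max u v)
  | point (x : V) : PathGen V
  | arrow (a : Quiver.Total V) : PathGen V

/-- The defining relations of the path algebra: the trivial paths are orthogonal idempotents
with sum `1`, and an arrow `a : x ⟶ y` satisfies `e_y a = a = a e_x`.  Products are written like
compositions of maps: in `b * a` the arrow `a` comes first. -/
inductive PathRel (k : Type w) [Field k] (V : Type u) [Fintype V] [Quiver.{v} V] :
    FreeAlgebra k (PathGen V) → FreeAlgebra k (PathGen V) → Prop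
  | idem (x : V) :
      PathRel k V (FreeAlgebra.ι k (.point x) * FreeAlgebra.ι k (.point x))
        (FreeAlgebra.ι k (.point x))
  | orth (x y : V) (h : x ≠ y) :
      PathRel k V (FreeAlgebra.ι k (.point x) * FreeAlgebra.ι k (.point y)) 0
  | sum : PathRel k V (∑ x : V, FreeAlgebra.ι k (.point x)) 1
  | target (a : Quiver.Total V) :
      PathRel k V (FreeAlgebra.ι k (.point a.right) * FreeAlgebra.ι k (.arrow a))
        (FreeAlgebra.ι k (.arrow a))
  | source (a : Quiver.Total V) :
      PathRel k V (FreeAlgebra.ι k (.arrow a) * FreeAlgebra.ι k (.point a.left))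
        (FreeAlgebra.ι k (.arrow a))

/-- The path algebra `kQ` of a quiver with finitely many points. -/
abbrev PathAlgebra (k : Type w) [Field k] (V : Type u) [Fintype V] [Quiver.{v} V] :
    Type (max u v w) :=
  RingQuot (PathRel k V)

/-- An arrow as an element of the path algebra. -/
def PathAlgebra.arrow (k : Type w) [Field k] {V : Type u} [Fintype V] [Quiver.{v} V]
    (a : Quiver.Total V) : PathAlgebra k V :=
  RingQuot.mkAlgHom k (PathRel k V) (FreeAlgebra.ι k (.arrow a))

/-- The path `aₙ ⋯ a₂ a₁` running first through `a₁`, then through `a₂`, and so on, for the list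
`[a₁, a₂, …, aₙ]` of consecutive arrows. -/
def PathAlgebra.path (k : Type w) [Field k] {V : Type u} [Fintype V] [Quiver.{v} V]
    (l : List (Quiver.Total V)) : PathAlgebra k V :=
  (l.map (PathAlgebra.arrow k)).reverse.prod

/-! ### Trivial extensions -/

/-- The `A`-`A`-bimodule `DA = Hom_k(A, k)` with `(a f b)(x) = f (b x a)`. -/
def DualBimodule (k : Type w) [Field k] (A : Type u) [Ring A] [Algebra k A] : Type (max u w) :=
  A →ₗ[k] k

namespace DualBimodule

variable {k : Type w} [Field k] {A : Type u} [Ring A] [Algebra k A]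

instance : AddCommGroup (DualBimodule k A) := inferInstanceAs (AddCommGroup (A →ₗ[k] k))

instance : Module k (DualBimodule k A) := inferInstanceAs (Module k (A →ₗ[k] k))

instance : FunLike (DualBimodule k A) A k := inferInstanceAs (FunLike (A →ₗ[k] k) A k)

theorem ext' {f g : DualBimodule k A} (h : ∀ x, f x = g x) : f = g := DFunLike.ext f g h

theorem add_apply' (f g : DualBimodule k A) (x : A) : (f + g) x = f x + g x := rfl

theorem zero_apply' (x : A) : (0 : DualBimodule k A) x = 0 := rfl

theorem smul_apply' (c : k) (f : DualBimodule k A) (x : A) : (c • f) x = c * f x := rfl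

theorem map_add' (f : DualBimodule k A) (x y : A) : f (x + y) = f x + f y :=
  LinearMap.map_add (show A →ₗ[k] k from f) x y

theorem map_zero' (f : DualBimodule k A) : f 0 = 0 :=
  LinearMap.map_zero (show A →ₗ[k] k from f)

theorem map_smul' (f : DualBimodule k A) (c : k) (x : A) : f (c • x) = c * f x :=
  LinearMap.map_smul (show A →ₗ[k] k from f) c x

/-- The left action `(a f)(x) = f (x a)`. -/
instance : SMul A (DualBimodule k A) :=
  ⟨fun a f => (show A →ₗ[k] k from f).comp (LinearMap.mulRight k a)⟩

/-- The right action `(f a)(x) = f (a x)`. -/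
instance : SMul Aᵐᵒᵖ (DualBimodule k A) :=
  ⟨fun a f => (show A →ₗ[k] k from f).comp (LinearMap.mulLeft k a.unop)⟩

theorem left_smul_apply (a : A) (f : DualBimodule k A) (x : A) : (a • f) x = f (x * a) := rfl

theorem right_smul_apply (a : Aᵐᵒᵖ) (f : DualBimodule k A) (x : A) :
    (a • f) x = f (a.unop * x) := rfl

instance : Module A (DualBimodule k A) where
  one_smul f := ext' fun x => by rw [left_smul_apply, mul_one]
  mul_smul a b f := ext' fun x => by simp only [left_smul_apply, mul_assoc]
  smul_zero a := ext' fun x => rfl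
  smul_add a f g := ext' fun x => rfl
  add_smul a b f := ext' fun x => by
    simp only [left_smul_apply, add_apply', mul_add, map_add']
  zero_smul f := ext' fun x => by
    simp only [left_smul_apply, mul_zero, map_zero', zero_apply']

instance : Module Aᵐᵒᵖ (DualBimodule k A) where
  one_smul f := ext' fun x => by rw [right_smul_apply, MulOpposite.unop_one, one_mul]
  mul_smul a b f := ext' fun x => by
    simp only [right_smul_apply, MulOpposite.unop_mul, mul_assoc]
  smul_zero a := ext' fun x => rfl
  smul_add a f g := ext' fun x => rfl
  add_smul a b f := ext' fun x => by
    simp only [right_smul_apply, add_apply', MulOpposite.unop_add, add_mul, map_add']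
  zero_smul f := ext' fun x => by
    simp only [right_smul_apply, MulOpposite.unop_zero, zero_mul, map_zero', zero_apply']

instance : SMulCommClass A Aᵐᵒᵖ (DualBimodule k A) where
  smul_comm a b f := ext' fun x => by
    simp only [left_smul_apply, right_smul_apply, mul_assoc]

instance : IsScalarTower k A (DualBimodule k A) where
  smul_assoc c a f := ext' fun x => by
    simp only [left_smul_apply, smul_apply', mul_smul_comm, map_smul']

instance : IsScalarTower k Aᵐᵒᵖ (DualBimodule k A) where
  smul_assoc c a f := ext' fun x => by
    simp only [right_smul_apply, smul_apply', MulOpposite.unop_smul, smul_mul_assoc, map_smul']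

end DualBimodule

/-- The trivial extension `T(A) = A ⊕ DA` with `(a, f)(b, g) = (ab, ag + fb)`. -/
abbrev TrivialExtension (k : Type w) [Field k] (A : Type u) [Ring A] [Algebra k A] :
    Type (max u w) :=
  TrivSqZeroExt A (DualBimodule k A)

/-! ### Pedigrees -/

/-- The two kinds of steps in a walk starting at the root: along an `α`-arrow, or backwards along
a `β`-arrow. -/
inductive PedigreeStep : Type
  | alpha
  | betaInv
  deriving DecidableEq

/-- A pedigree: a finite subtree, containing the root, of the infinite binary tree in which each
point `x` has the two children `x'` and `x''`, with arrows `β_x : x' ⟶ x` and `α_x : x ⟶ x''`.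
A point is identified with the walk leading to it from the root `[]`; as a word this walk is read
from the right to the left, so `x'` is `betaInv :: x` and `x''` is `alpha :: x`. -/
structure Pedigree where
  /-- The points. -/
  points : Finset (List PedigreeStep)
  root_mem : [] ∈ points
  parent_mem : ∀ (s : PedigreeStep) (x : List PedigreeStep), s :: x ∈ points → x ∈ points

namespace Pedigree

/-- The type of points of a pedigree. -/
abbrev Point (L : Pedigree) : Type := {x : List PedigreeStep // x ∈ L.points}

/-- The arrows of a pedigree. -/
inductive Arrow (L : Pedigree) : L.Point → L.Point → Type
  | alpha (x : L.Point) (h : PedigreeStep.alpha :: x.1 ∈ L.points) : Arrow L x ⟨_, h⟩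
  | beta (x : L.Point) (h : PedigreeStep.betaInv :: x.1 ∈ L.points) : Arrow L ⟨_, h⟩ x

instance (L : Pedigree) : Quiver.{0} L.Point := ⟨L.Arrow⟩

/-- The zero-relations `α_x β_x = 0`; these are all the paths `αβ` that occur in `L`. -/
inductive Rel (k : Type w) [Field k] (L : Pedigree) :
    PathAlgebra k L.Point → PathAlgebra k L.Point → Prop
  | alpha_beta (x : L.Point) (h' : PedigreeStep.betaInv :: x.1 ∈ L.points)
      (h'' : PedigreeStep.alpha :: x.1 ∈ L.points) :
      Rel k L (PathAlgebra.path k [⟨_, _, Arrow.beta x h'⟩, ⟨_, _, Arrow.alpha x h''⟩]) 0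

/-- The pedigree algebra `A_L`. -/
abbrev algebra (k : Type w) [Field k] (L : Pedigree) : Type w := RingQuot (L.Rel k)

end Pedigree

/-! ### Brauer-quivers -/

/-- A cycle of length `n ≥ 1` in a quiver: a closed path of length `n` leading through `n`
points, up to the choice of its starting point. -/
structure IsQuiverCycle {V : Type u} [Quiver.{v} V] (Z : Cycle (Quiver.Total V)) : Prop where
  ne_nil : Z ≠ Cycle.nil
  chain : Z.Chain fun a b => a.right = b.left
  nodup : (Z.map Quiver.Total.left).Nodup

/-- A Brauer-quiver: a finite connected quiver such that each arrow occurs in a cycle, each point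
belongs to exactly two cycles, and two different cycles have at most one point in common. -/
structure BrauerQuiver where
  /-- The points. -/
  Point : Type u
  [fintypePoint : Fintype Point]
  [quiver : Quiver.{v} Point]
  finite_arrows : Finite (Quiver.Total Point)
  nonempty : Nonempty Point
  connected : ∀ x y : Point, Relation.EqvGen (fun a b => Nonempty (a ⟶ b)) x y
  arrow_mem_cycle : ∀ a : Quiver.Total Point, ∃ Z : Cycle (Quiver.Total Point),
    IsQuiverCycle Z ∧ a ∈ Z
  two_cycles : ∀ x : Point, {Z : Cycle (Quiver.Total Point) |
    IsQuiverCycle Z ∧ x ∈ Z.map Quiver.Total.left}.ncard = 2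
  meet : ∀ Z Z' : Cycle (Quiver.Total Point), IsQuiverCycle Z → IsQuiverCycle Z' → Z ≠ Z' →
    ∀ x y : Point, x ∈ Z.map Quiver.Total.left → x ∈ Z'.map Quiver.Total.left →
      y ∈ Z.map Quiver.Total.left → y ∈ Z'.map Quiver.Total.left → x = y

namespace BrauerQuiver

attribute [instance] BrauerQuiver.fintypePoint BrauerQuiver.quiver

/-- The relations of the Brauer-quiver algebra.  In `zero`, a path `ba` of length two lies on a
cycle iff both arrows occur in that cycle, because no two arrows of a cycle start in the same
point.  In `zeta`, the lists `a :: l` and `a' :: l'` are the paths `ζ(x, Z)` and `ζ(x, Z')` running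
once through two cycles from their common point `x = a.left = a'.left` to itself. -/
inductive Rel (k : Type w) [Field k] (Q : BrauerQuiver.{u, v}) :
    PathAlgebra k Q.Point → PathAlgebra k Q.Point → Prop
  | zero (a b : Quiver.Total Q.Point) (hab : a.right = b.left)
      (h : ¬ ∃ Z : Cycle (Quiver.Total Q.Point), IsQuiverCycle Z ∧ a ∈ Z ∧ b ∈ Z) :
      Rel k Q (PathAlgebra.path k [a, b]) 0
  | zeta (a a' : Quiver.Total Q.Point) (l l' : List (Quiver.Total Q.Point))
      (hZ : IsQuiverCycle (↑(a :: l) : Cycle (Quiver.Total Q.Point)))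
      (hZ' : IsQuiverCycle (↑(a' :: l') : Cycle (Quiver.Total Q.Point)))
      (hx : a.left = a'.left) :
      Rel k Q (PathAlgebra.path k (a :: l)) (PathAlgebra.path k (a' :: l'))

/-- The Brauer-quiver algebra `B(Q)`. -/
abbrev algebra (k : Type w) [Field k] (Q : BrauerQuiver.{u, v}) : Type (max u v w) :=
  RingQuot (Q.Rel k)

end BrauerQuiver

end

/-! A line of a pedigree is a maximal run of arrows of one kind. Each point lies on one line of each
kind, possibly consisting of that point alone, and the nonzero paths of `A_L` are those inside a
single line. Close up each line by an arrow from its last point to its first. In `T(A_L)` let this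
closing arrow be the functional dual to the path through the whole line. Then a path crossing the
closing arrow once, and no longer than a full turn, is dual to the complementary path of the turn.
In particular a full turn at `x` is dual to the trivial path at `x`, whichever line is used; this is
the relation `ζ(x, Z) = ζ(x, Z')`. The resulting homomorphism from `B(Q)` to `T(A_L)` is inverted by
sending the dual of a path to its complement. `PedigreeModel.algEquiv` proves this for every quiver
identified with a closed-up pedigree in such a way that all cycles run along lines. `LineSystem` is
the common language for `A_L`, `T(A_L)` and `B(Q)`, and elementary matrices supply the dual
functionals.

It remains to produce such identifications, and both directions rest on the same fact: the two
lines, or cycles, through a point `p` are separated by removing `p`. In a pedigree the side of `p`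
on which a point lies can be read off its word, so a cycle cannot change lines
(`Pedigree.closedModel`). In a Brauer-quiver, a path avoiding `p` between the two sides would close
up to a forbidden cycle (`BrauerQuiver.Reach.sameCycle`).

For (b), declare some arrow to be the `α`-arrow at the root, so that words describe walks in `Q`,
and take the words whose walks are simple. Separation makes the simple walk to a point unique
(`BrauerQuiver.IsSimple.eq_of_left_eq`), and connectedness makes it exist. By
`BrauerQuiver.turn_walk_of_not_isSimple`, a step that destroys simplicity leads back to the foot of
the line, exactly as in the closed-up pedigree. -/

noncomputable section

/-! ### Removing the leading copies of a letter from a word -/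

section StripLead

variable {α : Type*} [DecidableEq α]

/-- The word `x` without its leading letters `c`. -/
def stripLead (c : α) : List α → List α
  | [] => []
  | d :: x => if d = c then stripLead c x else d :: x

@[simp]
theorem stripLead_cons_self (c : α) (x : List α) : stripLead c (c :: x) = stripLead c x := by
  simp [stripLead]

theorem stripLead_cons_of_ne {c d : α} (h : d ≠ c) (x : List α) :
    stripLead c (d :: x) = d :: x := by
  simp [stripLead, h]

theorem exists_eq_replicate_append_stripLead (c : α) (x : List α) :
    ∃ n, x = List.replicate n c ++ stripLead c x := by
  induction x with
  | nil => exact ⟨0, rfl⟩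
  | cons d x ih =>
    by_cases h : d = c
    · subst h
      obtain ⟨n, hn⟩ := ih
      refine ⟨n + 1, ?_⟩
      rw [stripLead_cons_self, List.replicate_succ, List.cons_append, ← hn]
    · exact ⟨0, by rw [stripLead_cons_of_ne h]; rfl⟩

theorem stripLead_suffix (c : α) (x : List α) : stripLead c x <:+ x := by
  obtain ⟨n, hn⟩ := exists_eq_replicate_append_stripLead c x
  exact ⟨_, hn.symm⟩

theorem stripLead_ne_cons (c : α) (x y : List α) : stripLead c x ≠ c :: y := by
  induction x with
  | nil => simp [stripLead]
  | cons d x ih =>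
    by_cases h : d = c
    · subst h
      rwa [stripLead_cons_self]
    · rw [stripLead_cons_of_ne h]
      simp [h]

@[simp]
theorem stripLead_stripLead (c : α) (x : List α) :
    stripLead c (stripLead c x) = stripLead c x := by
  rcases h : stripLead c x with _ | ⟨d, y⟩
  · rfl
  · refine stripLead_cons_of_ne ?_ y
    rintro rfl
    exact stripLead_ne_cons _ _ _ h

/-- Both words are powers of `c` on top of the same foot, so the longer one passes through the step
above the shorter one. Since pedigrees are closed under suffixes, only the highest point of a line
can lack a step above it. -/
theorem cons_suffix_of_stripLead_eq {c : α} {x y : List α} (h : stripLead c x = stripLead c y)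
    (hlen : x.length < y.length) : c :: x <:+ y := by
  obtain ⟨m, hm⟩ := exists_eq_replicate_append_stripLead c x
  obtain ⟨n, hn⟩ := exists_eq_replicate_append_stripLead c y
  have hmn : m < n := by
    rw [hm, hn] at hlen
    simp only [List.length_append, List.length_replicate, h] at hlen
    omega
  refine ⟨List.replicate (n - (m + 1)) c, ?_⟩
  have hx : c :: x = List.replicate (m + 1) c ++ stripLead c x := by
    rw [List.replicate_succ, List.cons_append, ← hm]
  rw [hx, h, ← List.append_assoc, ← List.replicate_add, Nat.sub_add_cancel hmn, ← hn]

end StripLead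

namespace Pedigree

variable (L : Pedigree)

variable {L} in
theorem mem_points_of_suffix {x y : List PedigreeStep} (h : x <:+ y) (hy : y ∈ L.points) :
    x ∈ L.points := by
  obtain ⟨z, rfl⟩ := h
  induction z with
  | nil => exact hy
  | cons s z ih => exact ih (L.parent_mem s _ hy)

/-! ### The cyclic permutations of the lines of a pedigree -/

/-- One step upwards on the line of `x` formed by the steps `c`, returning to the lowest point of
the line if `x` is its highest point. -/
def climb (c : PedigreeStep) (x : L.Point) : L.Point :=
  if h : c :: x.1 ∈ L.points then ⟨_, h⟩
  else ⟨stripLead c x.1, mem_points_of_suffix (stripLead_suffix c x.1) x.2⟩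

variable {L}

theorem climb_of_mem {c : PedigreeStep} {x : L.Point} (h : c :: x.1 ∈ L.points) :
    L.climb c x = ⟨_, h⟩ := dif_pos h

theorem climb_of_notMem {c : PedigreeStep} {x : L.Point} (h : c :: x.1 ∉ L.points) :
    (L.climb c x).1 = stripLead c x.1 := by
  rw [climb, dif_neg h]

theorem stripLead_climb (c : PedigreeStep) (x : L.Point) :
    stripLead c (L.climb c x).1 = stripLead c x.1 := by
  by_cases h : c :: x.1 ∈ L.points
  · rw [climb_of_mem h, stripLead_cons_self]
  · rw [climb_of_notMem h, stripLead_stripLead]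

theorem eq_of_stripLead_eq {c : PedigreeStep} {x y : L.Point}
    (h : stripLead c x.1 = stripLead c y.1) (hx : c :: x.1 ∉ L.points)
    (hy : c :: y.1 ∉ L.points) : x = y := by
  rcases lt_trichotomy x.1.length y.1.length with hlt | heq | hlt
  · exact absurd (mem_points_of_suffix (cons_suffix_of_stripLead_eq h hlt) y.2) hx
  · obtain ⟨m, hm⟩ := exists_eq_replicate_append_stripLead c x.1
    obtain ⟨n, hn⟩ := exists_eq_replicate_append_stripLead c y.1
    rw [hm, hn] at heq
    simp only [List.length_append, List.length_replicate, h] at heq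
    have hmn : m = n := by omega
    apply Subtype.ext
    rw [hm, hn, h, hmn]
  · exact absurd (mem_points_of_suffix (cons_suffix_of_stripLead_eq h.symm hlt) x.2) hy

/-- The foot `stripLead c x` is invariant under climbing. A genuine step yields a word beginning
with `c`, the wrap-around a word that does not, and each line has only one point that wraps around.
-/
theorem climb_injective (c : PedigreeStep) : Function.Injective (L.climb c) := by
  intro x y hxy
  have hstrip : stripLead c x.1 = stripLead c y.1 := by
    rw [← stripLead_climb, hxy, stripLead_climb]
  by_cases hx : c :: x.1 ∈ L.points <;> by_cases hy : c :: y.1 ∈ L.points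
  · rw [climb_of_mem hx, climb_of_mem hy] at hxy
    exact Subtype.ext (List.cons.inj (congrArg Subtype.val hxy)).2
  · have h := congrArg Subtype.val hxy
    rw [climb_of_mem hx, climb_of_notMem hy] at h
    exact absurd h.symm (stripLead_ne_cons _ _ _)
  · have h := congrArg Subtype.val hxy
    rw [climb_of_mem hy, climb_of_notMem hx] at h
    exact absurd h (stripLead_ne_cons _ _ _)
  · exact eq_of_stripLead_eq hstrip hx hy

variable (L)

/-- `climb` as a permutation. -/
def climbPerm (c : PedigreeStep) : Equiv.Perm L.Point :=
  Equiv.ofBijective _ (Finite.injective_iff_bijective.1 (climb_injective (L := L) c))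

@[simp]
theorem climbPerm_apply (c : PedigreeStep) (x : L.Point) : L.climbPerm c x = L.climb c x := rfl

/-- The next point on the line of `x` of the given kind, in the direction of the arrows; the last
point of a line is followed by the first one. -/
def next : PedigreeStep → Equiv.Perm L.Point
  | .alpha => L.climbPerm .alpha
  | .betaInv => (L.climbPerm .betaInv)⁻¹

/-- The arrow from `x` to `L.next c x` is an arrow of the pedigree, that is, `x` is not the last
point of its line. -/
def Inner : PedigreeStep → L.Point → Prop
  | .alpha, x => PedigreeStep.alpha :: x.1 ∈ L.points
  | .betaInv, x => PedigreeStep.betaInv :: (L.next .betaInv x).1 ∈ L.points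

variable {L}

theorem climb_next_betaInv (x : L.Point) : L.climb .betaInv (L.next .betaInv x) = x :=
  (L.climbPerm .betaInv).apply_symm_apply x

theorem next_betaInv_climb (x : L.Point) : L.next .betaInv (L.climb .betaInv x) = x :=
  (L.climbPerm .betaInv).symm_apply_apply x

theorem sameCycle_next_iff (c : PedigreeStep) (x y : L.Point) :
    (L.next c).SameCycle x y ↔ (L.climbPerm c).SameCycle x y := by
  cases c
  · rfl
  · exact Equiv.Perm.sameCycle_inv

theorem stripLead_eq_of_sameCycle {c : PedigreeStep} {x y : L.Point}
    (h : (L.climbPerm c).SameCycle x y) : stripLead c x.1 = stripLead c y.1 := by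
  obtain ⟨n, rfl⟩ := h.exists_nat_pow_eq
  clear h
  induction n with
  | zero => rfl
  | succ n ih => rw [pow_succ', Equiv.Perm.mul_apply, climbPerm_apply, stripLead_climb, ih]

/-- At a longest word of the orbit a genuine step would give a longer one. Together with
`eq_of_stripLead_eq` this gives each orbit exactly one closing arrow. -/
theorem exists_sameCycle_cons_notMem (c : PedigreeStep) (x : L.Point) :
    ∃ y, (L.climbPerm c).SameCycle x y ∧ c :: y.1 ∉ L.points := by
  classical
  obtain ⟨y, hy, hmax⟩ := Finset.exists_max_image
    (Finset.univ.filter fun y => (L.climbPerm c).SameCycle x y) (fun y => y.1.length)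
    ⟨x, by simp [Equiv.Perm.SameCycle.rfl]⟩
  simp only [Finset.mem_filter, Finset.mem_univ, true_and] at hy hmax
  refine ⟨y, hy, fun h => ?_⟩
  have h1 := hmax (L.climbPerm c y) (Equiv.Perm.sameCycle_apply_right.2 hy)
  rw [climbPerm_apply, climb_of_mem h] at h1
  simp at h1

theorem exists_sameCycle_not_inner (c : PedigreeStep) (x : L.Point) :
    ∃ y, (L.next c).SameCycle x y ∧ ¬ L.Inner c y := by
  obtain ⟨y, hy, h⟩ := exists_sameCycle_cons_notMem c x
  rw [← sameCycle_next_iff] at hy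
  cases c
  · exact ⟨y, hy, h⟩
  · refine ⟨L.climb .betaInv y, ?_, ?_⟩
    · rw [sameCycle_next_iff] at hy ⊢
      exact Equiv.Perm.sameCycle_apply_right.2 hy
    · rwa [Inner, next_betaInv_climb]

theorem eq_of_not_inner {c : PedigreeStep} {x y : L.Point} (h : (L.next c).SameCycle x y)
    (hx : ¬ L.Inner c x) (hy : ¬ L.Inner c y) : x = y := by
  cases c
  · exact eq_of_stripLead_eq (stripLead_eq_of_sameCycle h) hx hy
  · apply (L.next .betaInv).injective
    refine eq_of_stripLead_eq (stripLead_eq_of_sameCycle ?_) hx hy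
    rw [← sameCycle_next_iff]
    simpa using h

/-- The arrow from `x` to the next point of a line. -/
def innerArrow : (c : PedigreeStep) → (x : L.Point) → L.Inner c x → Quiver.Total L.Point
  | .alpha, x, h => ⟨x, ⟨_, h⟩, Arrow.alpha x h⟩
  | .betaInv, x, h => ⟨⟨_, h⟩, L.next .betaInv x, Arrow.beta (L.next .betaInv x) h⟩

theorem innerArrow_left (c : PedigreeStep) (x : L.Point) (h : L.Inner c x) :
    (innerArrow c x h).left = x := by
  cases c
  · rfl
  -- For `betaInv` the source is by construction the word above `L.next .betaInv x`; climbing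
  -- identifies it with `x`.
  · have h1 := climb_of_mem (c := .betaInv) (x := L.next .betaInv x) h
    rw [climb_next_betaInv] at h1
    exact h1.symm

theorem innerArrow_right (c : PedigreeStep) (x : L.Point) (h : L.Inner c x) :
    (innerArrow c x h).right = L.next c x := by
  cases c
  · exact (climb_of_mem (c := .alpha) (x := x) h).symm
  · rfl

theorem next_betaInv_of_mem {x : L.Point} (h : PedigreeStep.betaInv :: x.1 ∈ L.points) :
    L.next .betaInv ⟨_, h⟩ = x := by
  conv_rhs => rw [← next_betaInv_climb x, climb_of_mem h]

theorem inner_betaInv_of_mem {x : L.Point} (h : PedigreeStep.betaInv :: x.1 ∈ L.points) :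
    L.Inner .betaInv ⟨_, h⟩ := by
  rwa [Inner, next_betaInv_of_mem h]

theorem innerArrow_betaInv_of_mem {x : L.Point}
    (h : PedigreeStep.betaInv :: x.1 ∈ L.points) :
    innerArrow .betaInv ⟨_, h⟩ (inner_betaInv_of_mem h) = ⟨_, _, Arrow.beta x h⟩ := by
  -- The membership proof depends on the point, so the point is generalised before the equality is
  -- substituted.
  have key : ∀ (y : L.Point) (hy : y = x) (h' : PedigreeStep.betaInv :: y.1 ∈ L.points),
      (⟨_, _, Arrow.beta y h'⟩ : Quiver.Total L.Point) = ⟨_, _, Arrow.beta x h⟩ := by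
    rintro y rfl h'
    rfl
  exact key _ (next_betaInv_of_mem h) _

theorem exists_eq_innerArrow (a : Quiver.Total L.Point) : ∃ c x h, a = innerArrow c x h := by
  obtain ⟨_, _, a⟩ := a
  change L.Arrow _ _ at a
  cases a with
  | alpha _ h => exact ⟨.alpha, _, h, rfl⟩
  | beta _ h => exact ⟨.betaInv, _, inner_betaInv_of_mem h, (innerArrow_betaInv_of_mem h).symm⟩

end Pedigree

/-! ### The universal property of path algebras -/

namespace PathAlgebra

variable (k : Type w) [Field k] {V : Type u} [Fintype V] [Quiver.{v} V]

/-- The trivial path at a point as an element of the path algebra. -/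
def vertex (x : V) : PathAlgebra k V :=
  RingQuot.mkAlgHom k (PathRel k V) (FreeAlgebra.ι k (.point x))

theorem vertex_mul_self (x : V) : vertex k x * vertex k x = vertex k x := by
  simpa [vertex] using RingQuot.mkAlgHom_rel k (PathRel.idem (k := k) x)

theorem vertex_mul_of_ne {x y : V} (h : x ≠ y) : vertex k x * vertex k y = 0 := by
  simpa [vertex] using RingQuot.mkAlgHom_rel k (PathRel.orth (k := k) x y h)

theorem sum_vertex : ∑ x : V, vertex k x = 1 := by
  simpa [vertex] using RingQuot.mkAlgHom_rel k (PathRel.sum (k := k) (V := V))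

theorem vertex_mul_arrow (a : Quiver.Total V) : vertex k a.right * arrow k a = arrow k a := by
  simpa [vertex, arrow] using RingQuot.mkAlgHom_rel k (PathRel.target (k := k) a)

theorem arrow_mul_vertex (a : Quiver.Total V) : arrow k a * vertex k a.left = arrow k a := by
  simpa [vertex, arrow] using RingQuot.mkAlgHom_rel k (PathRel.source (k := k) a)

theorem adjoin_eq_top : Algebra.adjoin k
    (Set.range (vertex k) ∪ Set.range (arrow k) : Set (PathAlgebra k V)) = ⊤ := by
  have h := congrArg (Subalgebra.map (RingQuot.mkAlgHom k (PathRel k V)))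
    (FreeAlgebra.adjoin_range_ι k (PathGen V))
  rw [AlgHom.map_adjoin, Algebra.map_top,
    (AlgHom.range_eq_top _).2 (RingQuot.mkAlgHom_surjective k _)] at h
  rw [eq_top_iff, ← h]
  apply Algebra.adjoin_mono
  rintro _ ⟨_, ⟨x | a, rfl⟩, rfl⟩
  · exact Or.inl ⟨x, rfl⟩
  · exact Or.inr ⟨a, rfl⟩

variable {k} {R : Type*} [Ring R] [Algebra k R]

/-- The algebra homomorphism given by the images of the trivial paths and of the arrows. -/
def lift (e : V → R) (f : Quiver.Total V → R) (idem : ∀ x, e x * e x = e x)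
    (orth : ∀ x y, x ≠ y → e x * e y = 0) (sum : ∑ x, e x = 1)
    (target : ∀ a, e a.right * f a = f a) (source : ∀ a, f a * e a.left = f a) :
    PathAlgebra k V →ₐ[k] R :=
  RingQuot.liftAlgHom k ⟨FreeAlgebra.lift k fun g =>
    PathGen.casesOn g e f, by
      intro _ _ h
      cases h with
      | idem x => simpa using idem x
      | orth x y h => simpa using orth x y h
      | sum => simpa using sum
      | target a => simpa using target a
      | source a => simpa using source a⟩

section

variable (e : V → R) (f : Quiver.Total V → R) (idem : ∀ x, e x * e x = e x)
    (orth : ∀ x y, x ≠ y → e x * e y = 0) (sum : ∑ x, e x = 1)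
    (target : ∀ a, e a.right * f a = f a) (source : ∀ a, f a * e a.left = f a)

@[simp]
theorem lift_vertex (x : V) :
    lift (k := k) e f idem orth sum target source (vertex k x) = e x := by
  simp [lift, vertex]

@[simp]
theorem lift_arrow (a : Quiver.Total V) :
    lift (k := k) e f idem orth sum target source (arrow k a) = f a := by
  simp [lift, arrow]

end

theorem adjoin_image_eq_top {r : PathAlgebra k V → PathAlgebra k V → Prop} :
    Algebra.adjoin k (Set.range (fun x => RingQuot.mkAlgHom k r (vertex k x)) ∪
      Set.range fun a => RingQuot.mkAlgHom k r (arrow k a)) = ⊤ := by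
  have h := congrArg (Subalgebra.map (RingQuot.mkAlgHom k r)) (adjoin_eq_top k (V := V))
  rw [AlgHom.map_adjoin, Algebra.map_top,
    (AlgHom.range_eq_top _).2 (RingQuot.mkAlgHom_surjective k _), Set.image_union,
    ← Set.range_comp, ← Set.range_comp] at h
  exact h

end PathAlgebra

/-! ### Families of orthogonal idempotents and arrows along two permutations -/

/-- Orthogonal idempotents `e x` with sum `1`, indexed by the points of a finite set carrying two
permutations `s c`, and elements `arr c x` from `x` to `s c x`, such that arrows of different kinds
have product zero. -/
structure LineSystem {V : Type u} [Fintype V] (s : PedigreeStep → Equiv.Perm V)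
    (R : Type v) [Ring R] where
  /-- The idempotents. -/
  e : V → R
  /-- The arrows. -/
  arr : PedigreeStep → V → R
  idem : ∀ x, e x * e x = e x
  orth : ∀ x y, x ≠ y → e x * e y = 0
  sum_e : ∑ x, e x = 1
  target : ∀ c x, e (s c x) * arr c x = arr c x
  source : ∀ c x, arr c x * e x = arr c x
  cross : ∀ c d x, c ≠ d → arr d (s c x) * arr c x = 0

namespace LineSystem

variable {V : Type u} [Fintype V] {s : PedigreeStep → Equiv.Perm V} {R : Type v} [Ring R]
  (S : LineSystem s R)

/-- The product of the `n` consecutive arrows of kind `c` that starts in `x`. -/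
def path (c : PedigreeStep) (x : V) : ℕ → R
  | 0 => S.e x
  | n + 1 => S.arr c ((s c)^[n] x) * path c x n

@[simp]
theorem path_zero (c : PedigreeStep) (x : V) : S.path c x 0 = S.e x := rfl

theorem path_succ (c : PedigreeStep) (x : V) (n : ℕ) :
    S.path c x (n + 1) = S.arr c ((s c)^[n] x) * S.path c x n := rfl

theorem path_one (c : PedigreeStep) (x : V) : S.path c x 1 = S.arr c x := S.source c x

theorem e_mul_path (c : PedigreeStep) (x : V) (n : ℕ) :
    S.e ((s c)^[n] x) * S.path c x n = S.path c x n := by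
  cases n with
  | zero => exact S.idem x
  | succ n => rw [path_succ, ← mul_assoc, Function.iterate_succ_apply', S.target]

theorem e_mul_path_of_ne {c : PedigreeStep} {x y : V} {n : ℕ} (h : y ≠ (s c)^[n] x) :
    S.e y * S.path c x n = 0 := by
  rw [← S.e_mul_path, ← mul_assoc, S.orth _ _ h, zero_mul]

theorem arr_mul_path_of_ne {c d : PedigreeStep} {x y : V} {n : ℕ} (h : y ≠ (s c)^[n] x) :
    S.arr d y * S.path c x n = 0 := by
  rw [← S.source, mul_assoc, S.e_mul_path_of_ne h, mul_zero]

theorem arr_mul_path_cross {c d : PedigreeStep} (h : c ≠ d) (x : V) {n : ℕ} (hn : n ≠ 0) :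
    S.arr d ((s c)^[n] x) * S.path c x n = 0 := by
  obtain ⟨n, rfl⟩ := Nat.exists_eq_succ_of_ne_zero hn
  rw [path_succ, ← mul_assoc, Function.iterate_succ_apply', S.cross c d _ h, zero_mul]

theorem path_add (c : PedigreeStep) (x : V) (m n : ℕ) :
    S.path c x (m + n) = S.path c ((s c)^[m] x) n * S.path c x m := by
  induction n with
  | zero => exact (S.e_mul_path c x m).symm
  | succ n ih => rw [← add_assoc, path_succ, ih, path_succ, mul_assoc,
      ← Function.iterate_add_apply, add_comm n m]

theorem path_eq_prod (c : PedigreeStep) (x : V) {n : ℕ} (hn : n ≠ 0) :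
    S.path c x n = ((List.range n).map fun i => S.arr c ((s c)^[i] x)).reverse.prod := by
  obtain ⟨n, rfl⟩ := Nat.exists_eq_succ_of_ne_zero hn
  clear hn
  induction n with
  | zero => simp [path_one]
  | succ n ih =>
    rw [path_succ, ih, List.range_succ (n := n + 1)]
    simp

theorem map_path {R' : Type*} [Ring R'] (S' : LineSystem s R') {F : Type*} [FunLike F R R']
    [MulHomClass F R R'] (f : F) (he : ∀ x, f (S.e x) = S'.e x) (c : PedigreeStep) (x : V)
    (n : ℕ) (ha : ∀ i < n, f (S.arr c ((s c)^[i] x)) = S'.arr c ((s c)^[i] x)) :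
    f (S.path c x n) = S'.path c x n := by
  induction n with
  | zero => exact he x
  | succ n ih =>
    rw [path_succ, path_succ, map_mul, ha n n.lt_succ_self,
      ih fun i hi => ha i (hi.trans n.lt_succ_self)]

/-- The span of the paths inside single lines contains `1` and is stable under left multiplication
by the generators: each generator fixes, prolongs or kills such a path. -/
theorem span_path (k : Type*) [Field k] [Algebra k R]
    (hS : Algebra.adjoin k (Set.range S.e ∪ Set.range fun p : PedigreeStep × V => S.arr p.1 p.2)
      = ⊤) :
    Submodule.span k (Set.range fun p : PedigreeStep × V × ℕ => S.path p.1 p.2.1 p.2.2) = ⊤ := by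
  set M := Submodule.span k (Set.range fun p : PedigreeStep × V × ℕ => S.path p.1 p.2.1 p.2.2)
  have hmem : ∀ c x n, S.path c x n ∈ M := fun c x n => Submodule.subset_span ⟨(c, x, n), rfl⟩
  have hgen : ∀ r ∈ (Set.range S.e ∪ Set.range fun p : PedigreeStep × V => S.arr p.1 p.2),
      ∀ z ∈ M, r * z ∈ M := by
    intro r hr z hz
    induction hz using Submodule.span_induction with
    | zero => simp
    | add y z _ _ hy hz => rw [mul_add]; exact add_mem hy hz
    | smul t z _ hz => rw [mul_smul_comm]; exact M.smul_mem t hz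
    | mem z hz =>
      obtain ⟨⟨c, x, n⟩, rfl⟩ := hz
      rcases hr with ⟨y, rfl⟩ | ⟨⟨d, y⟩, rfl⟩
      · by_cases h : y = (s c)^[n] x
        · subst h
          simpa only [S.e_mul_path] using hmem c x n
        · simp only [S.e_mul_path_of_ne h, zero_mem]
      · by_cases h : y = (s c)^[n] x
        · subst h
          by_cases hcd : c = d
          · subst hcd
            exact hmem c x (n + 1)
          -- A trivial path belongs to lines of both kinds, so here an arrow of the other kind does
          -- not kill it but starts a new path.
          · by_cases hn : n = 0
            · subst hn
              exact hmem d x 1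
            · simp only [S.arr_mul_path_cross hcd x hn, zero_mem]
        · simp only [S.arr_mul_path_of_ne h, zero_mem]
  have hall : ∀ r : R, ∀ z ∈ M, r * z ∈ M := by
    intro r
    have hr : r ∈ Algebra.adjoin k
        (Set.range S.e ∪ Set.range fun p : PedigreeStep × V => S.arr p.1 p.2) := by
      rw [hS]
      trivial
    induction hr using Algebra.adjoin_induction with
    | mem r hr => exact hgen r hr
    | algebraMap t =>
      intro z hz
      rw [← Algebra.smul_def]
      exact M.smul_mem t hz
    | add a b _ _ ha hb =>
      intro z hz
      rw [add_mul]
      exact add_mem (ha z hz) (hb z hz)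
    | mul a b _ _ ha hb =>
      intro z hz
      rw [mul_assoc]
      exact ha _ (hb z hz)
  rw [eq_top_iff]
  intro r _
  rw [← mul_one r]
  refine hall r 1 ?_
  rw [← S.sum_e]
  exact sum_mem fun x _ => hmem .alpha x 0

end LineSystem

namespace Pedigree

variable (k : Type w) [Field k] (L : Pedigree)

/-! ### The pedigree algebra -/

open scoped Classical in
/-- The idempotents and arrows of the pedigree algebra; the arrow from the last to the first point
of a line is replaced by zero. -/
def lineSystem : LineSystem L.next (L.algebra k) where
  e x := RingQuot.mkAlgHom k (L.Rel k) (PathAlgebra.vertex k x)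
  arr c x := if h : L.Inner c x then
    RingQuot.mkAlgHom k (L.Rel k) (PathAlgebra.arrow k (innerArrow c x h)) else 0
  idem x := by rw [← map_mul, PathAlgebra.vertex_mul_self]
  orth x y h := by rw [← map_mul, PathAlgebra.vertex_mul_of_ne k h, map_zero]
  sum_e := by rw [← map_sum, PathAlgebra.sum_vertex, map_one]
  target c x := by
    split_ifs with h
    · rw [← innerArrow_right c x h, ← map_mul, PathAlgebra.vertex_mul_arrow]
    · rw [mul_zero]
  source c x := by
    split_ifs with h
    · conv_lhs => enter [2, 2, 2]; rw [← innerArrow_left c x h]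
      rw [← map_mul, PathAlgebra.arrow_mul_vertex]
    · rw [zero_mul]
  cross c d x hcd := by
    by_cases h : L.Inner c x
    swap
    · rw [dif_neg h, mul_zero]
    by_cases h' : L.Inner d (L.next c x)
    swap
    · rw [dif_neg h', zero_mul]
    rw [dif_pos h, dif_pos h']
    cases c <;> cases d
    · exact absurd rfl hcd
    -- A word cannot begin with both letters, so this composition does not occur in the tree; the
    -- opposite order is the defining zero-relation.
    · have h1 := climb_of_mem h'
      rw [climb_next_betaInv] at h1
      have h2 : L.next .alpha x = _ := climb_of_mem h
      have h3 := congrArg Subtype.val (h2.symm.trans h1)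
      exact absurd (List.cons.inj h3).1 (by simp)
    · have hrel := RingQuot.mkAlgHom_rel k (Rel.alpha_beta (k := k) (L.next .betaInv x) h h')
      simp only [map_zero, PathAlgebra.path, List.map_cons, List.map_nil, List.reverse_cons,
        List.reverse_nil, List.nil_append, List.cons_append, List.prod_cons, List.prod_nil,
        mul_one, map_mul] at hrel
      exact hrel
    · exact absurd rfl hcd

variable {L}

theorem lineSystem_arr {c : PedigreeStep} {x : L.Point} (h : L.Inner c x) :
    (L.lineSystem k).arr c x =
      RingQuot.mkAlgHom k (L.Rel k) (PathAlgebra.arrow k (innerArrow c x h)) := dif_pos h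

theorem lineSystem_arr_of_not {c : PedigreeStep} {x : L.Point} (h : ¬ L.Inner c x) :
    (L.lineSystem k).arr c x = 0 := dif_neg h

variable (L) in
theorem adjoin_lineSystem : Algebra.adjoin k (Set.range (L.lineSystem k).e ∪
    Set.range fun p : PedigreeStep × L.Point => (L.lineSystem k).arr p.1 p.2) = ⊤ := by
  rw [eq_top_iff, ← PathAlgebra.adjoin_image_eq_top]
  apply Algebra.adjoin_mono
  rintro _ (⟨x, rfl⟩ | ⟨a, rfl⟩)
  · exact Or.inl ⟨x, rfl⟩
  · obtain ⟨c, x, h, rfl⟩ := exists_eq_innerArrow a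
    exact Or.inr ⟨(c, x), lineSystem_arr k h⟩

/-- Such a path contains the closing arrow of its line, which is zero in `A_L`. -/
theorem path_eq_zero {c : PedigreeStep} {x : L.Point} {i n : ℕ} (hi : i < n)
    (h : ¬ L.Inner c ((L.next c)^[i] x)) : (L.lineSystem k).path c x n = 0 := by
  obtain ⟨m, rfl⟩ := Nat.exists_eq_add_of_lt hi
  rw [add_assoc, add_comm m 1, ← add_assoc, LineSystem.path_add, LineSystem.path_succ,
    lineSystem_arr_of_not k h, zero_mul, mul_zero]

theorem ext_path {M : Type*} [AddCommGroup M] [Module k M] {f g : L.algebra k →ₗ[k] M}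
    (h : ∀ c x n, f ((L.lineSystem k).path c x n) = g ((L.lineSystem k).path c x n)) : f = g := by
  refine LinearMap.ext_on ((L.lineSystem k).span_path k (adjoin_lineSystem k L)) ?_
  rintro _ ⟨⟨c, x, n⟩, rfl⟩
  exact h c x n

section Lift

variable {k} {R : Type*} [Ring R] [Algebra k R] (S : LineSystem L.next R)

/-- The image of an arrow of the pedigree in a line system. -/
def arrowImage (a : Quiver.Total L.Point) : R :=
  match a with
  | ⟨_, _, Arrow.alpha x _⟩ => S.arr .alpha x
  | ⟨_, _, Arrow.beta _ h⟩ => S.arr .betaInv ⟨_, h⟩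

theorem arrowImage_innerArrow (c : PedigreeStep) (x : L.Point) (h : L.Inner c x) :
    arrowImage S (innerArrow c x h) = S.arr c x := by
  cases c
  · rfl
  · exact congrArg (S.arr .betaInv) (innerArrow_left .betaInv x h)

variable (k) in
/-- The homomorphism from the pedigree algebra given by a line system. -/
def lift : L.algebra k →ₐ[k] R :=
  RingQuot.liftAlgHom k ⟨PathAlgebra.lift S.e (arrowImage S) S.idem S.orth S.sum_e
    (by
      intro a
      obtain ⟨c, x, h, rfl⟩ := exists_eq_innerArrow a
      rw [arrowImage_innerArrow, innerArrow_right, S.target])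
    (by
      intro a
      obtain ⟨c, x, h, rfl⟩ := exists_eq_innerArrow a
      rw [arrowImage_innerArrow, innerArrow_left, S.source]), by
      rintro _ _ ⟨x, h', h''⟩
      have h := S.cross .betaInv .alpha ⟨_, h'⟩ (by simp)
      rw [next_betaInv_of_mem] at h
      simpa [PathAlgebra.path, arrowImage] using h⟩

@[simp]
theorem lift_e (x : L.Point) : lift k S ((L.lineSystem k).e x) = S.e x := by
  simp [lift, lineSystem]

theorem lift_arr {c : PedigreeStep} {x : L.Point} (h : L.Inner c x) :
    lift k S ((L.lineSystem k).arr c x) = S.arr c x := by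
  rw [lineSystem_arr k h]
  simp [lift, arrowImage_innerArrow]

theorem lift_path {c : PedigreeStep} {x : L.Point} {n : ℕ}
    (h : ∀ i < n, L.Inner c ((L.next c)^[i] x)) :
    lift k S ((L.lineSystem k).path c x n) = S.path c x n :=
  (L.lineSystem k).map_path S (lift k S) (lift_e S) c x n fun i hi => lift_arr S (h i hi)

end Lift

/-! ### The two matrix representations -/

variable (L)

open scoped Classical in
/-- The elementary matrices of the arrows on the lines of kind `c`. -/
def matrixSystem (c : PedigreeStep) : LineSystem L.next (Matrix L.Point L.Point k) where
  e x := Matrix.single x x 1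
  arr d x := if d = c ∧ L.Inner c x then Matrix.single (L.next c x) x 1 else 0
  idem x := by simp
  orth x y h := by simp [h]
  sum_e := by
    ext i j
    rw [Matrix.sum_apply, Matrix.one_apply, Finset.sum_eq_single i]
    · simp [Matrix.single_apply]
    · intro x _ hx
      simp [hx]
    · simp
  target d x := by
    split_ifs with h
    · obtain ⟨rfl, h⟩ := h
      simp
    · simp
  source d x := by
    split_ifs with h <;> simp
  cross d d' x h := by
    by_cases hd : d = c
    · rw [if_neg (fun h' => h (hd.trans h'.1.symm)), zero_mul]
    · rw [if_neg (c := d = c ∧ _) (fun h' => hd h'.1), mul_zero]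

/-- The representation of the pedigree algebra on the lines of kind `c`. -/
def matrixRep (c : PedigreeStep) : L.algebra k →ₐ[k] Matrix L.Point L.Point k :=
  lift k (L.matrixSystem k c)

variable {L}

theorem matrixRep_e (c : PedigreeStep) (x : L.Point) :
    L.matrixRep k c ((L.lineSystem k).e x) = Matrix.single x x 1 := lift_e _ x

theorem matrixRep_arr {c : PedigreeStep} {x : L.Point} (h : L.Inner c x) :
    L.matrixRep k c ((L.lineSystem k).arr c x) = Matrix.single (L.next c x) x 1 := by
  rw [matrixRep, lift_arr _ h]
  simp [matrixSystem, h]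

theorem matrixRep_arr_of_ne {c d : PedigreeStep} (hcd : c ≠ d) (x : L.Point) :
    L.matrixRep k c ((L.lineSystem k).arr d x) = 0 := by
  by_cases h : L.Inner d x
  · rw [matrixRep, lift_arr _ h]
    simp [matrixSystem, hcd.symm]
  · rw [lineSystem_arr_of_not k h, map_zero]

/-- Distinct inner paths of kind `c` become distinct elementary matrices. This gives functionals
dual to the paths without first constructing a basis of the quotient algebra. -/
theorem matrixRep_path {c : PedigreeStep} {x : L.Point} {n : ℕ}
    (h : ∀ i < n, L.Inner c ((L.next c)^[i] x)) :
    L.matrixRep k c ((L.lineSystem k).path c x n) = Matrix.single ((L.next c)^[n] x) x 1 := by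
  induction n with
  | zero => exact matrixRep_e k c x
  | succ n ih =>
    rw [LineSystem.path_succ, map_mul, ih fun i hi => h i (hi.trans n.lt_succ_self),
      matrixRep_arr k (h n n.lt_succ_self), Function.iterate_succ_apply']
    simp

theorem matrixRep_path_of_ne {c d : PedigreeStep} (hcd : c ≠ d) (x : L.Point) {n : ℕ}
    (hn : n ≠ 0) : L.matrixRep k c ((L.lineSystem k).path d x n) = 0 := by
  obtain ⟨n, rfl⟩ := Nat.exists_eq_succ_of_ne_zero hn
  rw [LineSystem.path_succ, map_mul, matrixRep_arr_of_ne k hcd, zero_mul]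

/-! ### Coordinate functionals -/

/-- The functional on the pedigree algebra taking the entry at `(x, y)` of the representation on
the lines of kind `c`; if there is a path from `y` to `x` in such a line, it is dual to it. -/
def entry (c : PedigreeStep) (x y : L.Point) : DualBimodule k (L.algebra k) :=
  Matrix.entryLinearMap k k x y ∘ₗ (L.matrixRep k c).toLinearMap

theorem entry_apply (c : PedigreeStep) (x y : L.Point) (a : L.algebra k) :
    entry k c x y a = L.matrixRep k c a x y := rfl

/-- The left action on functionals is right multiplication of the argument, and column `y` of `b *
single z y 1` is column `z` of `b`. -/
theorem smul_entry {c : PedigreeStep} {a : L.algebra k} {y z : L.Point}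
    (ha : L.matrixRep k c a = Matrix.single z y 1) (x : L.Point) :
    a • entry k c x y = entry k c x z := by
  refine DualBimodule.ext' fun b => ?_
  rw [DualBimodule.left_smul_apply, entry_apply, entry_apply, map_mul, ha]
  simp

theorem op_smul_entry {c : PedigreeStep} {a : L.algebra k} {x z : L.Point}
    (ha : L.matrixRep k c a = Matrix.single x z 1) (y : L.Point) :
    MulOpposite.op a • entry k c x y = entry k c z y := by
  refine DualBimodule.ext' fun b => ?_
  rw [DualBimodule.right_smul_apply, entry_apply, entry_apply, map_mul, MulOpposite.unop_op, ha]
  simp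

theorem smul_entry_of_eq_zero {c : PedigreeStep} {a : L.algebra k}
    (ha : L.matrixRep k c a = 0) (x y : L.Point) : a • entry k c x y = 0 := by
  refine DualBimodule.ext' fun b => ?_
  rw [DualBimodule.left_smul_apply, entry_apply, map_mul, ha, mul_zero]
  rfl

theorem op_smul_entry_of_eq_zero {c : PedigreeStep} {a : L.algebra k}
    (ha : L.matrixRep k c a = 0) (x y : L.Point) : MulOpposite.op a • entry k c x y = 0 := by
  refine DualBimodule.ext' fun b => ?_
  rw [DualBimodule.right_smul_apply, entry_apply, map_mul, MulOpposite.unop_op, ha, zero_mul]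
  rfl

/-! ### The trivial extension -/

open TrivSqZeroExt

variable (L)

open scoped Classical in
/-- The idempotents and arrows of the trivial extension. The arrow from the last to the first
point of a line is dual to the path running through the line. -/
def trivExtSystem : LineSystem L.next (TrivialExtension k (L.algebra k)) where
  e x := inl ((L.lineSystem k).e x)
  arr c x := if L.Inner c x then inl ((L.lineSystem k).arr c x)
    else inr (entry k c x (L.next c x))
  idem x := by rw [inl_mul_inl, LineSystem.idem]
  orth x y h := by rw [inl_mul_inl, LineSystem.orth _ _ _ h, inl_zero]
  sum_e := by
    rw [← inl_one, ← (L.lineSystem k).sum_e]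
    exact (map_sum (inlHom _ _) _ _).symm
  target c x := by
    split_ifs with h
    · rw [inl_mul_inl, LineSystem.target]
    · rw [inl_mul_inr, smul_entry k (matrixRep_e k c _)]
  source c x := by
    split_ifs with h
    · rw [inl_mul_inl, LineSystem.source]
    · rw [inr_mul_inl, op_smul_entry k (matrixRep_e k c _)]
  cross c d x hcd := by
    by_cases h : L.Inner c x <;> by_cases h' : L.Inner d (L.next c x)
    · rw [if_pos h, if_pos h', inl_mul_inl, LineSystem.cross _ _ _ _ hcd, inl_zero]
    · rw [if_pos h, if_neg h', inr_mul_inl,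
        op_smul_entry_of_eq_zero k (matrixRep_arr_of_ne k hcd.symm x), inr_zero]
    · rw [if_neg h, if_pos h', inl_mul_inr,
        smul_entry_of_eq_zero k (matrixRep_arr_of_ne k hcd _), inr_zero]
    · rw [if_neg h, if_neg h', inr_mul_inr]

variable {L}

theorem trivExtSystem_arr {c : PedigreeStep} {x : L.Point} (h : L.Inner c x) :
    (L.trivExtSystem k).arr c x = inl ((L.lineSystem k).arr c x) := if_pos h

theorem trivExtSystem_arr_of_not {c : PedigreeStep} {x : L.Point} (h : ¬ L.Inner c x) :
    (L.trivExtSystem k).arr c x = inr (entry k c x (L.next c x)) := if_neg h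

theorem trivExtSystem_path {c : PedigreeStep} {x : L.Point} {n : ℕ}
    (h : ∀ i < n, L.Inner c ((L.next c)^[i] x)) :
    (L.trivExtSystem k).path c x n = inl ((L.lineSystem k).path c x n) :=
  ((L.lineSystem k).map_path (L.trivExtSystem k) (inlHom _ _) (fun _ => rfl) c x n
    fun i hi => (trivExtSystem_arr k (h i hi)).symm).symm

/-- Cut the path at its only closing arrow. The part before it acts from the right and moves the row
index of the functional; the part after it acts from the left and moves the column index. -/
theorem trivExtSystem_path_of_not {c : PedigreeStep} {x : L.Point} {i n : ℕ} (hi : i < n)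
    (hi' : ¬ L.Inner c ((L.next c)^[i] x))
    (h : ∀ j < n, j ≠ i → L.Inner c ((L.next c)^[j] x)) :
    (L.trivExtSystem k).path c x n = inr (entry k c x ((L.next c)^[n] x)) := by
  obtain ⟨m, rfl⟩ := Nat.exists_eq_add_of_lt hi
  have h1 : ∀ j < i, L.Inner c ((L.next c)^[j] x) := fun j hj =>
    h j (hj.trans hi) hj.ne
  have h2 : ∀ j < m, L.Inner c ((L.next c)^[j] ((L.next c)^[i + 1] x)) := by
    intro j hj
    rw [← Function.iterate_add_apply]
    exact h _ (by omega) (by omega)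
  rw [add_assoc, add_comm m 1, ← add_assoc, LineSystem.path_add, LineSystem.path_succ,
    trivExtSystem_path k h1, trivExtSystem_path k h2, trivExtSystem_arr_of_not k hi',
    inr_mul_inl, op_smul_entry k (matrixRep_path k h1), inl_mul_inr,
    ← Function.iterate_succ_apply' (L.next c), smul_entry k (matrixRep_path k h2),
    ← Function.iterate_add_apply, add_comm m]

end Pedigree

/-! ### Cycles in quivers -/

namespace IsQuiverCycle

variable {V : Type u} [Quiver.{v} V] {Z : Cycle (Quiver.Total V)}

theorem _root_.Cycle.exists_cons_eq {α : Type*} {Z : Cycle α} {a : α} (ha : a ∈ Z) :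
    ∃ l : List α, Z = ↑(a :: l) := by
  induction Z using Quotient.inductionOn with
  | h l =>
    obtain ⟨l₁, l₂, rfl⟩ := List.append_of_mem (Cycle.mem_coe_iff.1 ha)
    exact ⟨l₂ ++ l₁, Cycle.coe_eq_coe.2 List.isRotated_append⟩

theorem eq_of_left_eq (hZ : IsQuiverCycle Z) {a b : Quiver.Total V} (ha : a ∈ Z) (hb : b ∈ Z)
    (h : a.left = b.left) : a = b := by
  induction Z using Quotient.inductionOn with
  | h l => exact List.inj_on_of_nodup_map (Cycle.nodup_coe_iff.1 hZ.nodup) ha hb h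

theorem isChain {a : Quiver.Total V} {l : List (Quiver.Total V)}
    (hZ : IsQuiverCycle (↑(a :: l) : Cycle (Quiver.Total V))) :
    (a :: (l ++ [a])).IsChain fun a b => a.right = b.left :=
  (Cycle.chain_coe_cons _ _ _).1 hZ.chain

theorem nodup_cons {a : Quiver.Total V} {l : List (Quiver.Total V)}
    (hZ : IsQuiverCycle (↑(a :: l) : Cycle (Quiver.Total V))) :
    ((a :: l).map Quiver.Total.left).Nodup :=
  Cycle.nodup_coe_iff.1 hZ.nodup

theorem exists_next (hZ : IsQuiverCycle Z) {a : Quiver.Total V} (ha : a ∈ Z) :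
    ∃ b ∈ Z, b.left = a.right := by
  obtain ⟨l, rfl⟩ := Cycle.exists_cons_eq ha
  have h := hZ.isChain
  rcases l with _ | ⟨b, l⟩
  · exact ⟨a, ha, (List.isChain_cons_cons.1 h).1.symm⟩
  · exact ⟨b, by simp, (List.isChain_cons_cons.1 h).1.symm⟩

theorem exists_prev (hZ : IsQuiverCycle Z) {a : Quiver.Total V} (ha : a ∈ Z) :
    ∃ b ∈ Z, b.right = a.left := by
  obtain ⟨l, rfl⟩ := Cycle.exists_cons_eq ha
  have h := hZ.isChain
  rcases List.eq_nil_or_concat l with rfl | ⟨l, b, rfl⟩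
  · exact ⟨a, ha, (List.isChain_cons_cons.1 h).1⟩
  · refine ⟨b, by simp, ?_⟩
    have h' : ((a :: l) ++ [b, a]).IsChain fun a b => a.right = b.left := by simpa using h
    exact (List.isChain_cons_cons.1 (List.isChain_append.1 h').2.1).1

/-- An arrow of a cycle is determined by its starting point, so the arrow following `b` can only be
`f b`. The cycle closes after its own length, and a shorter period would repeat its first arrow too
early. -/
theorem cons_eq_map_iterate {f : Quiver.Total V → Quiver.Total V}
    (hf : ∀ a, (f a).left = a.right) {a : Quiver.Total V} {l : List (Quiver.Total V)}
    (hZ : IsQuiverCycle (↑(a :: l) : Cycle (Quiver.Total V))) (hcl : ∀ b ∈ a :: l, f b ∈ a :: l) :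
    a :: l = (List.range (Function.minimalPeriod f a)).map fun i => f^[i] a := by
  have hch := List.isChain_iff_getElem.1 hZ.isChain
  have hit : ∀ i (hi : i < (a :: (l ++ [a])).length), (a :: (l ++ [a]))[i] = f^[i] a := by
    intro i
    induction i with
    | zero => intro _; rfl
    | succ i ih =>
      intro hi
      have h1 := hch i hi
      have hmem : ∀ b ∈ a :: (l ++ [a]), b ∈ a :: l := by
        intro b hb
        simp only [List.mem_cons, List.mem_append, List.not_mem_nil, or_false] at hb ⊢
        tauto
      rw [Function.iterate_succ_apply', ← ih (by omega)]
      refine hZ.eq_of_left_eq (hmem _ (List.getElem_mem _))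
        (hcl _ (hmem _ (List.getElem_mem _))) ?_
      rw [hf]
      exact h1.symm
  have hit' : ∀ i (hi : i < (a :: l).length), (a :: l)[i] = f^[i] a := by
    intro i hi
    rw [← hit i (by simp at hi ⊢; omega)]
    have : a :: (l ++ [a]) = (a :: l) ++ [a] := rfl
    simp only [this]
    rw [List.getElem_append_left hi]
  have hper : Function.IsPeriodicPt f (l.length + 1) a := by
    rw [Function.IsPeriodicPt, Function.IsFixedPt, ← hit (l.length + 1) (by simp)]
    simp
  have hle := hper.minimalPeriod_le (Nat.succ_pos _)
  have hpos := hper.minimalPeriod_pos (Nat.succ_pos _)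
  have heq : Function.minimalPeriod f a = l.length + 1 := by
    by_contra hne
    have hlt : Function.minimalPeriod f a < (a :: l).length := by
      simp only [List.length_cons]
      omega
    have h := hit' _ hlt
    rw [Function.iterate_minimalPeriod] at h
    have hnd : (a :: l).Nodup := List.Nodup.of_map _ hZ.nodup_cons
    have := (hnd.getElem_inj_iff (hi := hlt) (hj := Nat.succ_pos _)).1 (h.trans rfl)
    omega
  apply List.ext_getElem
  · simp [heq]
  · intro i h1 h2
    simp [hit' i h1]

end IsQuiverCycle

/-! ### Periods of the lines of a pedigree -/

instance : Fintype PedigreeStep where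
  elems := {.alpha, .betaInv}
  complete x := by cases x <;> simp

theorem DualBimodule.sum_apply' {k : Type w} [Field k] {A : Type u} [Ring A] [Algebra k A]
    {ι : Type*} (s : Finset ι) (f : ι → DualBimodule k A) (x : A) :
    (∑ i ∈ s, f i) x = ∑ i ∈ s, f i x :=
  map_sum (AddMonoidHom.mk' (fun g : DualBimodule k A => g x) fun _ _ => rfl) f s

namespace Pedigree

variable (L : Pedigree)

/-- The number of points on a line. -/
def period (c : PedigreeStep) (x : L.Point) : ℕ := Function.minimalPeriod (L.next c) x

variable {L}

theorem mem_periodicPts_next (c : PedigreeStep) (x : L.Point) :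
    x ∈ Function.periodicPts (L.next c) :=
  (L.next c).injective.mem_periodicPts x

theorem period_pos (c : PedigreeStep) (x : L.Point) : 0 < L.period c x :=
  Function.minimalPeriod_pos_of_mem_periodicPts (mem_periodicPts_next c x)

theorem iterate_period (c : PedigreeStep) (x : L.Point) : (L.next c)^[L.period c x] x = x :=
  Function.iterate_minimalPeriod

theorem period_iterate (c : PedigreeStep) (x : L.Point) (n : ℕ) :
    L.period c ((L.next c)^[n] x) = L.period c x :=
  Function.minimalPeriod_apply_iterate (mem_periodicPts_next c x) n

theorem eq_of_iterate_eq {c : PedigreeStep} {x : L.Point} {m n : ℕ} (hm : m < L.period c x)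
    (hn : n < L.period c x) (h : (L.next c)^[m] x = (L.next c)^[n] x) : m = n :=
  (Function.iterate_eq_iterate_iff_of_lt_minimalPeriod hm hn).1 h

theorem iterate_ne {c : PedigreeStep} {x : L.Point} {n : ℕ} (h0 : n ≠ 0)
    (hn : n < L.period c x) : (L.next c)^[n] x ≠ x := fun h =>
  h0 (eq_of_iterate_eq hn (period_pos c x) h)

theorem sameCycle_iterate (c : PedigreeStep) (x : L.Point) (n : ℕ) :
    (L.next c).SameCycle x ((L.next c)^[n] x) := by
  rw [← Equiv.Perm.coe_pow, Equiv.Perm.sameCycle_pow_right]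

/-- Every turn contains exactly one closing arrow: the orbit has a single point without an inner
arrow, and the iterates below the period are distinct. -/
theorem exists_lt_period_not_inner (c : PedigreeStep) (x : L.Point) :
    ∃ i < L.period c x, ¬ L.Inner c ((L.next c)^[i] x) ∧
      ∀ j < L.period c x, j ≠ i → L.Inner c ((L.next c)^[j] x) := by
  obtain ⟨y, hy, h⟩ := exists_sameCycle_not_inner c x
  obtain ⟨n, rfl⟩ := hy.exists_nat_pow_eq
  rw [Equiv.Perm.coe_pow, ← Function.iterate_mod_minimalPeriod_eq] at h
  have hlt : n % L.period c x < L.period c x := Nat.mod_lt _ (period_pos c x)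
  refine ⟨_, hlt, h, fun j hj hne => by_contra fun hj' => hne (eq_of_iterate_eq hj hlt ?_)⟩
  exact eq_of_not_inner ((sameCycle_iterate c x j).symm.trans (sameCycle_iterate c x _)) hj' h

theorem lt_period_of_inner {c : PedigreeStep} {x : L.Point} {n : ℕ}
    (h : ∀ i < n, L.Inner c ((L.next c)^[i] x)) : n < L.period c x := by
  obtain ⟨i, hi, hi', -⟩ := exists_lt_period_not_inner c x
  by_contra hn
  exact hi' (h i (hi.trans_le (not_lt.1 hn)))

variable (k : Type w) [Field k]

open TrivSqZeroExt

/-- The inner path from `x` avoids the closing arrow, so the rest of the turn crosses it exactly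
once. For `n = 0` the rest is the full turn, dual to the trivial path. -/
theorem trivExtSystem_path_complement {c : PedigreeStep} {x : L.Point} {n : ℕ}
    (h : ∀ i < n, L.Inner c ((L.next c)^[i] x)) :
    (L.trivExtSystem k).path c ((L.next c)^[n] x) (L.period c x - n) =
      inr (entry k c ((L.next c)^[n] x) x) := by
  obtain ⟨i, hi, hi', hu⟩ := exists_lt_period_not_inner c x
  have hn := lt_period_of_inner h
  have hni : n ≤ i := not_lt.1 fun hlt => hi' (h i hlt)
  have hit : ∀ j, n ≤ j → (L.next c)^[j - n] ((L.next c)^[n] x) = (L.next c)^[j] x := by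
    intro j hj
    rw [← Function.iterate_add_apply, Nat.sub_add_cancel hj]
  rw [trivExtSystem_path_of_not k (i := i - n) (by omega) (by rwa [hit i hni]), hit _ hn.le,
    iterate_period]
  intro j hj hne
  have := hu (j + n) (by omega) (by omega)
  rwa [Function.iterate_add_apply] at this

theorem trivExtSystem_path_period (c : PedigreeStep) (x : L.Point) :
    (L.trivExtSystem k).path c x (L.period c x) = inr (entry k c x x) :=
  trivExtSystem_path_complement k (n := 0) (by simp)

theorem entry_e (c : PedigreeStep) (x y z : L.Point) [Decidable (z = x ∧ z = y)] :
    entry k c x y ((L.lineSystem k).e z) = if z = x ∧ z = y then 1 else 0 := by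
  rw [entry_apply, matrixRep_e, Matrix.single_apply]
  congr

theorem entry_path {c : PedigreeStep} {z : L.Point} {n : ℕ}
    (h : ∀ i < n, L.Inner c ((L.next c)^[i] z)) :
    entry k c ((L.next c)^[n] z) z ((L.lineSystem k).path c z n) = 1 := by
  rw [entry_apply, matrixRep_path k h, Matrix.single_apply_same]

theorem entry_path_of_ne {c d : PedigreeStep} {x y z : L.Point} {n : ℕ} (hn : n ≠ 0)
    (h : ¬ (c = d ∧ (L.next c)^[n] z = x ∧ z = y)) :
    entry k c x y ((L.lineSystem k).path d z n) = 0 := by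
  by_cases hcd : c = d
  · subst hcd
    by_cases hin : ∀ i < n, L.Inner c ((L.next c)^[i] z)
    · rw [entry_apply, matrixRep_path k hin, Matrix.single_apply_of_ne]
      exact fun h' => h ⟨rfl, h'⟩
    · push Not at hin
      obtain ⟨i, hi, hi'⟩ := hin
      rw [path_eq_zero k hi hi', DualBimodule.map_zero']
  · rw [entry_apply, matrixRep_path_of_ne k hcd z hn, Matrix.zero_apply]

/-- A nonzero path is shorter than the period of its line, so it cannot return to its starting point
when its length is positive. -/
theorem entry_self_path (c d : PedigreeStep) (x z : L.Point) {n : ℕ} (hn : n ≠ 0) :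
    entry k c x x ((L.lineSystem k).path d z n) = 0 := by
  by_cases hin : ∀ i < n, L.Inner d ((L.next d)^[i] z)
  · refine entry_path_of_ne k hn ?_
    rintro ⟨rfl, h1, rfl⟩
    exact iterate_ne hn (lt_period_of_inner hin) h1
  · push Not at hin
    obtain ⟨i, hi, hi'⟩ := hin
    rw [path_eq_zero k hi hi', DualBimodule.map_zero']

theorem dualBimodule_ext {f g : DualBimodule k (L.algebra k)}
    (h : ∀ c x n, f ((L.lineSystem k).path c x n) = g ((L.lineSystem k).path c x n)) : f = g :=
  ext_path k h

/-- Both functionals take the coefficient of the trivial path at `x`. This is what makes the two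
full turns at `x` agree in the trivial extension. -/
theorem entry_self_eq (c d : PedigreeStep) (x : L.Point) :
    entry k c x x = entry k d x x := by
  classical
  refine dualBimodule_ext k fun c' z n => ?_
  by_cases hn : n = 0
  · subst hn
    rw [LineSystem.path_zero, entry_e, entry_e]
  · rw [entry_self_path k _ _ _ _ hn, entry_self_path k _ _ _ _ hn]

/-- Every functional is the combination of the functionals dual to the paths. -/
theorem dualBimodule_eq_sum (f : DualBimodule k (L.algebra k)) :
    ∑ x, f ((L.lineSystem k).e x) • entry k .alpha x x +
      ∑ c, ∑ x, ∑ n ∈ Finset.Ico 1 (L.period c x),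
        f ((L.lineSystem k).path c x n) • entry k c ((L.next c)^[n] x) x = f := by
  classical
  refine dualBimodule_ext k fun d z m => ?_
  simp only [DualBimodule.add_apply', DualBimodule.sum_apply', DualBimodule.smul_apply']
  -- The trivial paths are common to both kinds and are counted once, in the first sum with the
  -- arbitrary choice `.alpha`; hence the other sums start at length `1`.
  by_cases hm : m = 0
  · subst hm
    simp only [LineSystem.path_zero, entry_e]
    rw [Finset.sum_eq_single z, Finset.sum_eq_zero]
    · simp
    · intro c _
      refine Finset.sum_eq_zero fun x _ => Finset.sum_eq_zero fun n hn => ?_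
      rw [Finset.mem_Ico] at hn
      rw [if_neg, mul_zero]
      rintro ⟨h1, rfl⟩
      exact iterate_ne (by omega) hn.2 h1.symm
    · intro x _ hx
      simp [Ne.symm hx]
    · simp
  rw [Finset.sum_eq_zero fun x _ => by rw [entry_self_path k _ _ _ _ hm, mul_zero], zero_add]
  by_cases hin : ∀ i < m, L.Inner d ((L.next d)^[i] z)
  · have hlt := lt_period_of_inner hin
    rw [Finset.sum_eq_single d, Finset.sum_eq_single z, Finset.sum_eq_single m,
      entry_path k hin, mul_one]
    · intro n hn hnm
      rw [Finset.mem_Ico] at hn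
      rw [entry_path_of_ne k hm, mul_zero]
      rintro ⟨-, h1, -⟩
      exact hnm (eq_of_iterate_eq hn.2 hlt h1.symm)
    · intro h
      exact absurd (Finset.mem_Ico.2 ⟨Nat.one_le_iff_ne_zero.2 hm, hlt⟩) h
    · intro x _ hx
      refine Finset.sum_eq_zero fun n _ => ?_
      rw [entry_path_of_ne k hm fun h => hx h.2.2.symm, mul_zero]
    · simp
    · intro c _ hc
      refine Finset.sum_eq_zero fun x _ => Finset.sum_eq_zero fun n _ => ?_
      rw [entry_path_of_ne k hm fun h => hc h.1, mul_zero]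
    · simp
  · push Not at hin
    obtain ⟨i, hi, hi'⟩ := hin
    rw [path_eq_zero k hi hi', DualBimodule.map_zero']
    exact Finset.sum_eq_zero fun c _ => Finset.sum_eq_zero fun x _ => Finset.sum_eq_zero
      fun n _ => by rw [DualBimodule.map_zero', mul_zero]

end Pedigree

/-! ### Models of quivers by closed-up pedigrees, and their cycles -/

/-- An identification of a quiver with the quiver obtained from a pedigree by
closing up its lines, such that the cycles run along the lines. -/
structure PedigreeModel (L : Pedigree) (V : Type u) [Quiver.{v} V] where
  /-- The identification of the points. -/
  point : L.Point ≃ V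
  /-- The identification of the arrows. -/
  arrow : PedigreeStep × L.Point ≃ Quiver.Total V
  left : ∀ c x, (arrow (c, x)).left = point x
  right : ∀ c x, (arrow (c, x)).right = point (L.next c x)
  closed : ∀ Z : Cycle (Quiver.Total V), IsQuiverCycle Z → ∀ c x, arrow (c, x) ∈ Z →
    arrow (c, L.next c x) ∈ Z

namespace PedigreeModel

section Cycles

variable {L : Pedigree} {V : Type u} [Quiver.{v} V] (m : PedigreeModel L V)

/-- The arrow following a given arrow on its line. -/
def nextArrow (a : Quiver.Total V) : Quiver.Total V :=
  m.arrow ((m.arrow.symm a).1, L.next (m.arrow.symm a).1 (m.arrow.symm a).2)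

theorem nextArrow_arrow (c : PedigreeStep) (x : L.Point) :
    m.nextArrow (m.arrow (c, x)) = m.arrow (c, L.next c x) := by
  simp [nextArrow]

theorem iterate_nextArrow (c : PedigreeStep) (x : L.Point) (n : ℕ) :
    m.nextArrow^[n] (m.arrow (c, x)) = m.arrow (c, (L.next c)^[n] x) := by
  induction n with
  | zero => rfl
  | succ n ih => rw [Function.iterate_succ_apply', ih, nextArrow_arrow,
      Function.iterate_succ_apply']

theorem minimalPeriod_nextArrow (c : PedigreeStep) (x : L.Point) :
    Function.minimalPeriod m.nextArrow (m.arrow (c, x)) = L.period c x := by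
  refine Function.minimalPeriod_eq_minimalPeriod_iff.2 fun n => ?_
  rw [Function.IsPeriodicPt, Function.IsFixedPt, iterate_nextArrow, m.arrow.injective.eq_iff,
    Prod.mk.injEq, eq_self_iff_true, true_and]
  rfl

theorem left_nextArrow (a : Quiver.Total V) : (m.nextArrow a).left = a.right := by
  obtain ⟨⟨c, x⟩, rfl⟩ := m.arrow.surjective a
  rw [nextArrow_arrow, left, right]

/-- The field `closed` makes a cycle stable under `nextArrow`, so it is an orbit of `nextArrow`: the
cycles of the quiver are the closed-up lines. -/
theorem cons_eq_of_isQuiverCycle {c : PedigreeStep} {x : L.Point}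
    {l : List (Quiver.Total V)}
    (h : IsQuiverCycle (↑(m.arrow (c, x) :: l) : Cycle (Quiver.Total V))) :
    m.arrow (c, x) :: l =
      (List.range (L.period c x)).map fun i => m.arrow (c, (L.next c)^[i] x) := by
  rw [h.cons_eq_map_iterate m.left_nextArrow, minimalPeriod_nextArrow]
  · simp only [iterate_nextArrow]
  · intro b hb
    obtain ⟨⟨d, y⟩, rfl⟩ := m.arrow.surjective b
    rw [nextArrow_arrow]
    exact m.closed _ h d y hb

/-- The cycle running through a line. -/
def lineCycle (c : PedigreeStep) (x : L.Point) : Cycle (Quiver.Total V) :=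
  ↑((List.range (L.period c x)).map fun i => m.arrow (c, (L.next c)^[i] x))

theorem eq_lineCycle {c : PedigreeStep} {x : L.Point} {Z : Cycle (Quiver.Total V)}
    (hZ : IsQuiverCycle Z) (h : m.arrow (c, x) ∈ Z) : Z = m.lineCycle c x := by
  obtain ⟨l, rfl⟩ := Cycle.exists_cons_eq h
  rw [lineCycle, ← m.cons_eq_of_isQuiverCycle hZ]

theorem exists_eq_of_mem_lineCycle {c : PedigreeStep} {x : L.Point} {a : Quiver.Total V}
    (h : a ∈ m.lineCycle c x) : ∃ n, a = m.arrow (c, (L.next c)^[n] x) := by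
  rw [lineCycle, Cycle.mem_coe_iff, List.mem_map] at h
  obtain ⟨n, -, hn⟩ := h
  exact ⟨n, hn.symm⟩

theorem arrow_mem_lineCycle (c : PedigreeStep) (x : L.Point) :
    m.arrow (c, x) ∈ m.lineCycle c x := by
  rw [lineCycle, Cycle.mem_coe_iff, List.mem_map]
  exact ⟨0, List.mem_range.2 (Pedigree.period_pos c x), rfl⟩

theorem isQuiverCycle_lineCycle (c : PedigreeStep) (x : L.Point) :
    IsQuiverCycle (m.lineCycle c x) where
  ne_nil := by
    intro h
    have := m.arrow_mem_lineCycle c x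
    rw [h] at this
    exact Cycle.notMem_nil _ this
  chain := by
    obtain ⟨n, hn⟩ := Nat.exists_eq_succ_of_ne_zero (Pedigree.period_pos c x).ne'
    have hper := Pedigree.iterate_period c x
    rw [lineCycle, hn, ← Cycle.map_coe, Cycle.chain_map, Cycle.chain_range_succ]
    constructor
    · rw [m.left, m.right, ← Function.iterate_succ_apply' (L.next c), ← hn, hper]
      rfl
    · intro i _
      rw [m.left, m.right, Function.iterate_succ_apply']
  nodup := by
    rw [lineCycle, Cycle.map_coe, Cycle.nodup_coe_iff, List.map_map]
    refine List.Nodup.map_on ?_ List.nodup_range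
    intro i hi j hj hij
    simp only [Function.comp, m.left, m.point.injective.eq_iff] at hij
    exact Pedigree.eq_of_iterate_eq (List.mem_range.1 hi) (List.mem_range.1 hj) hij

/-- By `closed` the cycle already contains the continuation of the same kind, and only one of its
arrows starts in a given point. Hence changing lines is a zero-relation of the Brauer-quiver
algebra. -/
theorem not_mem_of_ne {c d : PedigreeStep} (hcd : c ≠ d) (x : L.Point)
    {Z : Cycle (Quiver.Total V)} (hZ : IsQuiverCycle Z) (hx : m.arrow (c, x) ∈ Z) :
    m.arrow (d, L.next c x) ∉ Z := by
  intro h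
  have := hZ.eq_of_left_eq h (m.closed Z hZ c x hx) (by rw [m.left, m.left])
  rw [m.arrow.injective.eq_iff, Prod.mk.injEq] at this
  exact hcd this.1.symm

end Cycles

/-! ### The Brauer-quiver algebra of a modelled quiver -/

variable {L : Pedigree} {Q : BrauerQuiver.{u, v}} (m : PedigreeModel L Q.Point)

variable (k : Type w) [Field k]

/-- The idempotents and arrows of the Brauer-quiver algebra. -/
def system : LineSystem L.next (Q.algebra k) where
  e x := RingQuot.mkAlgHom k (Q.Rel k) (PathAlgebra.vertex k (m.point x))
  arr c x := RingQuot.mkAlgHom k (Q.Rel k) (PathAlgebra.arrow k (m.arrow (c, x)))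
  idem x := by rw [← map_mul, PathAlgebra.vertex_mul_self]
  orth x y h := by
    rw [← map_mul, PathAlgebra.vertex_mul_of_ne k (m.point.injective.ne h), map_zero]
  sum_e := by
    rw [← map_sum, m.point.sum_comp (PathAlgebra.vertex k), PathAlgebra.sum_vertex, map_one]
  target c x := by rw [← m.right, ← map_mul, PathAlgebra.vertex_mul_arrow]
  source c x := by rw [← m.left c, ← map_mul, PathAlgebra.arrow_mul_vertex]
  cross c d x hcd := by
    have h := RingQuot.mkAlgHom_rel k (BrauerQuiver.Rel.zero (k := k) (m.arrow (c, x))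
      (m.arrow (d, L.next c x)) (by rw [m.left, m.right])
      (fun ⟨Z, hZ, h1, h2⟩ => m.not_mem_of_ne hcd x hZ h1 h2))
    simpa [PathAlgebra.path] using h

theorem system_path (c : PedigreeStep) (x : L.Point) {n : ℕ} (hn : n ≠ 0) :
    (m.system k).path c x n = RingQuot.mkAlgHom k (Q.Rel k)
      (PathAlgebra.path k ((List.range n).map fun i => m.arrow (c, (L.next c)^[i] x))) := by
  rw [LineSystem.path_eq_prod _ _ _ hn, PathAlgebra.path, map_list_prod, List.map_reverse,
    List.map_map, List.map_map]
  rfl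

theorem system_path_period (c d : PedigreeStep) (x : L.Point) :
    (m.system k).path c x (L.period c x) = (m.system k).path d x (L.period d x) := by
  rw [system_path _ _ _ _ (Pedigree.period_pos c x).ne',
    system_path _ _ _ _ (Pedigree.period_pos d x).ne']
  have key : ∀ c, ∃ l, (List.range (L.period c x)).map (fun i => m.arrow (c, (L.next c)^[i] x)) =
      m.arrow (c, x) :: l := by
    intro c
    obtain ⟨n, hn⟩ := Nat.exists_eq_succ_of_ne_zero (Pedigree.period_pos c x).ne'
    rw [hn, List.range_succ_eq_map, List.map_cons]
    exact ⟨_, rfl⟩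
  obtain ⟨l, hl⟩ := key c
  obtain ⟨l', hl'⟩ := key d
  have h := m.isQuiverCycle_lineCycle c x
  have h' := m.isQuiverCycle_lineCycle d x
  rw [lineCycle, hl] at h
  rw [lineCycle, hl'] at h'
  rw [hl, hl']
  exact RingQuot.mkAlgHom_rel k (BrauerQuiver.Rel.zeta _ _ _ _ h h' (by rw [m.left, m.left]))

/-- A full turn equals the full turn along the other line through `x`, and following that one by an
arrow of kind `c` changes lines, which gives zero. -/
theorem system_path_eq_zero {c : PedigreeStep} {x : L.Point} {n : ℕ} (hn : L.period c x < n) :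
    (m.system k).path c x n = 0 := by
  obtain ⟨i, rfl⟩ := Nat.exists_eq_add_of_lt hn
  obtain ⟨d, hd⟩ : ∃ d, d ≠ c := by
    cases c
    · exact ⟨.betaInv, by simp⟩
    · exact ⟨.alpha, by simp⟩
  have h0 : (m.system k).path c x (L.period c x + 1) = 0 := by
    rw [LineSystem.path_succ, system_path_period m k c d, Pedigree.iterate_period]
    have h := (m.system k).arr_mul_path_cross hd x (Pedigree.period_pos d x).ne'
    rwa [Pedigree.iterate_period] at h
  rw [add_assoc, add_comm i, ← add_assoc, LineSystem.path_add, h0, mul_zero]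

theorem adjoin_system : Algebra.adjoin k (Set.range (m.system k).e ∪
    Set.range fun p : PedigreeStep × L.Point => (m.system k).arr p.1 p.2) = ⊤ := by
  rw [eq_top_iff, ← PathAlgebra.adjoin_image_eq_top]
  apply Algebra.adjoin_mono
  rintro _ (⟨x, rfl⟩ | ⟨a, rfl⟩)
  · obtain ⟨x, rfl⟩ := m.point.surjective x
    exact Or.inl ⟨x, rfl⟩
  · obtain ⟨p, rfl⟩ := m.arrow.surjective a
    exact Or.inr ⟨p, rfl⟩

section Lift

variable {k} {R : Type*} [Ring R] [Algebra k R] (S : LineSystem L.next R)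
  (hS : ∀ c d x, S.path c x (L.period c x) = S.path d x (L.period d x))

variable (k) in
/-- The homomorphism from the path algebra given by a line system. -/
def pathLift : PathAlgebra k Q.Point →ₐ[k] R :=
  PathAlgebra.lift (fun x => S.e (m.point.symm x))
    (fun a => S.arr (m.arrow.symm a).1 (m.arrow.symm a).2)
    (fun x => S.idem _) (fun x y h => S.orth _ _ (m.point.symm.injective.ne h))
    (by rw [m.point.symm.sum_comp S.e, S.sum_e])
    (by
      intro a
      obtain ⟨⟨c, x⟩, rfl⟩ := m.arrow.surjective a
      simp [m.right, S.target])
    (by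
      intro a
      obtain ⟨⟨c, x⟩, rfl⟩ := m.arrow.surjective a
      simp [m.left, S.source])

theorem pathLift_vertex (x : L.Point) :
    m.pathLift k S (PathAlgebra.vertex k (m.point x)) = S.e x := by
  simp [pathLift]

theorem pathLift_arrow (c : PedigreeStep) (x : L.Point) :
    m.pathLift k S (PathAlgebra.arrow k (m.arrow (c, x))) = S.arr c x := by
  simp [pathLift]

theorem pathLift_path (c : PedigreeStep) (x : L.Point) {n : ℕ} (hn : n ≠ 0) :
    m.pathLift k S (PathAlgebra.path k
      ((List.range n).map fun i => m.arrow (c, (L.next c)^[i] x))) = S.path c x n := by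
  rw [LineSystem.path_eq_prod _ _ _ hn, PathAlgebra.path, map_list_prod, List.map_reverse,
    List.map_map, List.map_map]
  simp only [Function.comp_def, pathLift_arrow]

/-- A composable pair on no cycle must change kind, since lines are cycles, so `S.cross` applies.
The cycles in a `zeta` relation are full turns along lines, which is the case covered by `hS`. -/
theorem pathLift_rel
    (hS : ∀ c d x, S.path c x (L.period c x) = S.path d x (L.period d x)) {a b : PathAlgebra k Q.Point} (h : Q.Rel k a b) :
    m.pathLift k S a = m.pathLift k S b := by
  cases h with
  | zero a b hab h =>
    obtain ⟨⟨c, x⟩, rfl⟩ := m.arrow.surjective a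
    obtain ⟨⟨d, y⟩, rfl⟩ := m.arrow.surjective b
    rw [m.left, m.right, m.point.injective.eq_iff] at hab
    subst hab
    have hcd : c ≠ d := by
      rintro rfl
      exact h ⟨_, m.isQuiverCycle_lineCycle c x, m.arrow_mem_lineCycle c x,
        m.closed _ (m.isQuiverCycle_lineCycle c x) _ _ (m.arrow_mem_lineCycle c x)⟩
    simp [PathAlgebra.path, pathLift_arrow, S.cross c d x hcd]
  | zeta a a' l l' hZ hZ' hx =>
    obtain ⟨⟨c, x⟩, rfl⟩ := m.arrow.surjective a
    obtain ⟨⟨d, y⟩, rfl⟩ := m.arrow.surjective a'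
    rw [m.left, m.left, m.point.injective.eq_iff] at hx
    subst hx
    rw [m.cons_eq_of_isQuiverCycle hZ, m.cons_eq_of_isQuiverCycle hZ',
      pathLift_path _ _ _ _ (Pedigree.period_pos c x).ne',
      pathLift_path _ _ _ _ (Pedigree.period_pos d x).ne', hS c d x]

variable (k) in
/-- The homomorphism from the Brauer-quiver algebra given by a line system in which the two cycles
at each point have the same value. -/
def lift : Q.algebra k →ₐ[k] R :=
  RingQuot.liftAlgHom k ⟨m.pathLift k S, fun _ _ h => m.pathLift_rel S hS h⟩

theorem lift_path (c : PedigreeStep) (x : L.Point) (n : ℕ) :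
    m.lift k S hS ((m.system k).path c x n) = S.path c x n :=
  (m.system k).map_path S (m.lift k S hS)
    (fun x => by simp [lift, system, pathLift_vertex]) c x n
    fun i _ => by simp [lift, system, pathLift_arrow]

end Lift

/-! ### The isomorphism with the trivial extension -/

open TrivSqZeroExt

/-- The homomorphism from the Brauer-quiver algebra to the trivial extension. -/
def toTrivExt : Q.algebra k →ₐ[k] TrivialExtension k (L.algebra k) :=
  m.lift k (L.trivExtSystem k) fun c d x => by
    rw [Pedigree.trivExtSystem_path_period, Pedigree.trivExtSystem_path_period,
      Pedigree.entry_self_eq k c d]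

theorem toTrivExt_path (c : PedigreeStep) (x : L.Point) (n : ℕ) :
    m.toTrivExt k ((m.system k).path c x n) = (L.trivExtSystem k).path c x n :=
  m.lift_path _ _ c x n

/-- The element of the Brauer-quiver algebra corresponding to a functional on the pedigree
algebra. -/
def ofDual : DualBimodule k (L.algebra k) →ₗ[k] Q.algebra k where
  toFun f := ∑ x, f ((L.lineSystem k).e x) • (m.system k).path .alpha x (L.period .alpha x) +
    ∑ c, ∑ x, ∑ n ∈ Finset.Ico 1 (L.period c x), f ((L.lineSystem k).path c x n) •
      (m.system k).path c ((L.next c)^[n] x) (L.period c x - n)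
  map_add' f g := by
    simp only [DualBimodule.add_apply', add_smul, Finset.sum_add_distrib]
    abel
  map_smul' t f := by
    simp only [DualBimodule.smul_apply', mul_smul, ← Finset.smul_sum, ← smul_add,
      RingHom.id_apply]

theorem ofDual_apply (f : DualBimodule k (L.algebra k)) :
    m.ofDual k f =
      ∑ x, f ((L.lineSystem k).e x) • (m.system k).path .alpha x (L.period .alpha x) +
      ∑ c, ∑ x, ∑ n ∈ Finset.Ico 1 (L.period c x), f ((L.lineSystem k).path c x n) •
        (m.system k).path c ((L.next c)^[n] x) (L.period c x - n) := rfl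

theorem ofDual_entry_self (c : PedigreeStep) (x : L.Point) :
    m.ofDual k (Pedigree.entry k c x x) = (m.system k).path c x (L.period c x) := by
  classical
  rw [ofDual_apply, Finset.sum_eq_single x, Finset.sum_eq_zero, add_zero, Pedigree.entry_e,
    if_pos ⟨rfl, rfl⟩, one_smul, m.system_path_period k .alpha c]
  · intro d _
    refine Finset.sum_eq_zero fun z _ => Finset.sum_eq_zero fun n hn => ?_
    rw [Finset.mem_Ico] at hn
    rw [Pedigree.entry_self_path k _ _ _ _ (by omega), zero_smul]
  · intro z _ hz
    rw [Pedigree.entry_e, if_neg fun h => hz h.1, zero_smul]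
  · simp

/-- The functional is dual to an inner path of positive length, so only one term of the defining sum
survives, namely the complement of that path. -/
theorem ofDual_entry {c : PedigreeStep} {y : L.Point} {n : ℕ} (h0 : n ≠ 0)
    (h : ∀ i < n, L.Inner c ((L.next c)^[i] y)) :
    m.ofDual k (Pedigree.entry k c ((L.next c)^[n] y) y) =
      (m.system k).path c ((L.next c)^[n] y) (L.period c y - n) := by
  classical
  have hlt := Pedigree.lt_period_of_inner h
  rw [ofDual_apply, Finset.sum_eq_zero, zero_add, Finset.sum_eq_single c,
    Finset.sum_eq_single y, Finset.sum_eq_single n, Pedigree.entry_path k h, one_smul]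
  · intro i hi hin
    rw [Finset.mem_Ico] at hi
    rw [Pedigree.entry_path_of_ne k (by omega), zero_smul]
    rintro ⟨-, h1, -⟩
    exact hin (Pedigree.eq_of_iterate_eq hi.2 hlt h1)
  · intro h
    exact absurd (Finset.mem_Ico.2 ⟨Nat.one_le_iff_ne_zero.2 h0, hlt⟩) h
  · intro z _ hz
    refine Finset.sum_eq_zero fun i hi => ?_
    rw [Finset.mem_Ico] at hi
    rw [Pedigree.entry_path_of_ne k (by omega) fun h => hz h.2.2, zero_smul]
  · simp
  · intro d _ hd
    refine Finset.sum_eq_zero fun z _ => Finset.sum_eq_zero fun i hi => ?_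
    rw [Finset.mem_Ico] at hi
    rw [Pedigree.entry_path_of_ne k (by omega) fun h => hd h.1.symm, zero_smul]
  · simp
  · intro z _
    rw [Pedigree.entry_e, if_neg, zero_smul]
    rintro ⟨h1, h2⟩
    exact Pedigree.iterate_ne h0 hlt (h1.symm.trans h2)

/-- Expand `f` by `dualBimodule_eq_sum` and compare term by term: the complement of an inner path
maps to the functional dual to it, and all other paths have coefficient zero. -/
theorem toTrivExt_ofDual (f : DualBimodule k (L.algebra k)) :
    m.toTrivExt k (m.ofDual k f) = inr f := by
  have hinr : ∀ {ι : Type} (s : Finset ι) (g : ι → DualBimodule k (L.algebra k)),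
      (inr (∑ i ∈ s, g i) : TrivialExtension k (L.algebra k)) = ∑ i ∈ s, inr (g i) :=
    fun s g => map_sum (inrHom (L.algebra k) (DualBimodule k (L.algebra k))) g s
  conv_rhs => rw [← Pedigree.dualBimodule_eq_sum k f]
  rw [ofDual_apply]
  simp only [map_add, map_sum, map_smul, toTrivExt_path, inr_add, hinr, inr_smul]
  congr 1
  · exact Finset.sum_congr rfl fun x _ => by rw [Pedigree.trivExtSystem_path_period]
  · refine Finset.sum_congr rfl fun c _ => Finset.sum_congr rfl fun x _ =>
      Finset.sum_congr rfl fun n _ => ?_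
    by_cases h : ∀ i < n, L.Inner c ((L.next c)^[i] x)
    · rw [Pedigree.trivExtSystem_path_complement k h]
    · push Not at h
      obtain ⟨i, hi, hi'⟩ := h
      rw [Pedigree.path_eq_zero k hi hi', DualBimodule.map_zero', zero_smul, zero_smul]

theorem toTrivExt_lift (a : L.algebra k) :
    m.toTrivExt k (Pedigree.lift k (m.system k) a) = inl a := by
  have : ((m.toTrivExt k).comp (Pedigree.lift k (m.system k))).toLinearMap =
      (inlAlgHom k (L.algebra k) (DualBimodule k (L.algebra k))).toLinearMap := by
    refine Pedigree.ext_path (M := TrivialExtension k (L.algebra k)) k fun c x n => ?_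
    by_cases h : ∀ i < n, L.Inner c ((L.next c)^[i] x)
    · simp only [AlgHom.toLinearMap_apply, AlgHom.comp_apply, inlAlgHom_apply]
      rw [Pedigree.lift_path _ h, toTrivExt_path, Pedigree.trivExtSystem_path k h]
    · push Not at h
      obtain ⟨i, hi, hi'⟩ := h
      rw [Pedigree.path_eq_zero k hi hi', map_zero, map_zero]
  exact LinearMap.congr_fun this a

/-- The inverse of `toTrivExt`. -/
def ofTrivExt (t : TrivialExtension k (L.algebra k)) : Q.algebra k :=
  Pedigree.lift k (m.system k) t.fst + m.ofDual k t.snd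

theorem toTrivExt_ofTrivExt (t : TrivialExtension k (L.algebra k)) :
    m.toTrivExt k (m.ofTrivExt k t) = t := by
  rw [ofTrivExt, map_add, toTrivExt_lift, toTrivExt_ofDual, inl_fst_add_inr_snd_eq]

theorem ofTrivExt_inl (a : L.algebra k) :
    m.ofTrivExt k (inl a) = Pedigree.lift k (m.system k) a := by
  simp [ofTrivExt]

theorem ofTrivExt_inr (f : DualBimodule k (L.algebra k)) :
    m.ofTrivExt k (inr f) = m.ofDual k f := by
  simp [ofTrivExt]

theorem ofTrivExt_path (c : PedigreeStep) (x : L.Point) (n : ℕ) :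
    m.ofTrivExt k ((L.trivExtSystem k).path c x n) = (m.system k).path c x n := by
  by_cases h : ∀ i < n, L.Inner c ((L.next c)^[i] x)
  · rw [Pedigree.trivExtSystem_path k h, ofTrivExt_inl, Pedigree.lift_path _ h]
  -- Below a full turn the closing arrow is crossed once and the complement is inner; a full turn is
  -- dual to a trivial path; anything longer vanishes on both sides.
  rcases lt_trichotomy n (L.period c x) with hn | hn | hn
  · obtain ⟨i, hi, hi', hu⟩ := Pedigree.exists_lt_period_not_inner c x
    have hin : i < n := by
      by_contra hin
      exact h fun j hj => hu j (hj.trans hn) (by omega)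
    have hy : (L.next c)^[L.period c x - n] ((L.next c)^[n] x) = x := by
      rw [← Function.iterate_add_apply, Nat.sub_add_cancel hn.le, Pedigree.iterate_period]
    have hinner : ∀ j < L.period c x - n, L.Inner c ((L.next c)^[j] ((L.next c)^[n] x)) := by
      intro j hj
      rw [← Function.iterate_add_apply]
      exact hu _ (by omega) (by omega)
    have key := m.ofDual_entry k (by omega) hinner
    rw [hy, Pedigree.period_iterate, Nat.sub_sub_self hn.le] at key
    rw [Pedigree.trivExtSystem_path_of_not k hin hi' fun j hj => hu j (hj.trans hn),
      ofTrivExt_inr, key]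
  · rw [hn, Pedigree.trivExtSystem_path_period, ofTrivExt_inr, ofDual_entry_self]
  -- Vanishing in the trivial extension is not computed there but carried over by `toTrivExt`.
  · rw [m.system_path_eq_zero k hn, ← toTrivExt_path m k c x n, m.system_path_eq_zero k hn,
      map_zero]
    simp [ofTrivExt]

/-- The candidate inverse is not known to be multiplicative, but it is linear, so checking the
spanning set of paths suffices. -/
theorem ofTrivExt_toTrivExt (b : Q.algebra k) : m.ofTrivExt k (m.toTrivExt k b) = b := by
  let g : Q.algebra k →ₗ[k] Q.algebra k :=
    { toFun := fun b => m.ofTrivExt k (m.toTrivExt k b)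
      map_add' := fun a b => by
        simp only [ofTrivExt, map_add, fst_add, snd_add]
        abel
      map_smul' := fun t a => by
        simp only [ofTrivExt, map_smul, fst_smul, snd_smul, smul_add, RingHom.id_apply] }
  have hg : g = LinearMap.id := by
    refine LinearMap.ext_on ((m.system k).span_path k (m.adjoin_system k)) ?_
    rintro _ ⟨⟨c, x, n⟩, rfl⟩
    change m.ofTrivExt k (m.toTrivExt k ((m.system k).path c x n)) = (m.system k).path c x n
    rw [toTrivExt_path, ofTrivExt_path]
  exact LinearMap.congr_fun hg b

/-- The Brauer-quiver algebra is the trivial extension of the pedigree algebra. -/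
def algEquiv : Q.algebra k ≃ₐ[k] TrivialExtension k (L.algebra k) :=
  AlgEquiv.ofBijective (m.toTrivExt k)
    ⟨Function.LeftInverse.injective (m.ofTrivExt_toTrivExt k),
      Function.RightInverse.surjective (m.toTrivExt_ofTrivExt k)⟩

end PedigreeModel

/-! ### Cut points in a pedigree -/

theorem List.cons_suffix_replicate_append {α : Type*} {c : α} {n : ℕ} (hn : n ≠ 0) (p : List α) :
    c :: p <:+ List.replicate n c ++ p := by
  obtain ⟨n, rfl⟩ := Nat.exists_eq_succ_of_ne_zero hn
  refine ⟨List.replicate n c, ?_⟩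
  rw [List.replicate_succ', List.append_assoc]
  rfl

theorem List.eq_of_cons_suffix_replicate_append {α : Type*} {c d : α} {n : ℕ} {p : List α}
    (h : d :: p <:+ List.replicate n c ++ p) : d = c := by
  induction n with
  | zero => exact absurd h.length_le (by simp)
  | succ n ih =>
    rw [List.replicate_succ, List.cons_append, List.suffix_cons_iff] at h
    rcases h with h | h
    · exact (List.cons.inj h).1
    · exact ih h

/-- A suffix `d :: p` reaching into the leading block forces `d = c`, and then `p` is `z` or begins
with `c`; the hypotheses exclude both. -/
theorem List.cons_suffix_of_suffix_replicate_append {α : Type*} {c d : α} {n : ℕ}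
    {p z : List α} (hp : ∀ q, p ≠ d :: q) (hz : z ≠ p)
    (h : d :: p <:+ List.replicate n c ++ z) : d :: p <:+ z := by
  induction n with
  | zero => exact h
  | succ n ih =>
    rw [List.replicate_succ, List.cons_append, List.suffix_cons_iff] at h
    rcases h with h | h
    · obtain ⟨rfl, h⟩ := List.cons.inj h
      cases n with
      | zero => exact absurd h.symm hz
      | succ n => exact absurd h (hp _)
    · exact ih h

/-- The other kind of step. -/
def PedigreeStep.other : PedigreeStep → PedigreeStep
  | .alpha => .betaInv
  | .betaInv => .alpha

theorem PedigreeStep.other_eq_of_ne {c d : PedigreeStep} (h : c ≠ d) : c.other = d := by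
  cases c <;> cases d <;> simp_all [PedigreeStep.other]

theorem PedigreeStep.other_ne (c : PedigreeStep) : c.other ≠ c := by
  cases c <;> simp [PedigreeStep.other]

namespace Pedigree

variable {L : Pedigree}

/-- A step that is not the last step of the walk leading to a point. -/
def freeStep : List PedigreeStep → PedigreeStep
  | [] => .alpha
  | c :: _ => c.other

theorem ne_freeStep_cons (p q : List PedigreeStep) : p ≠ freeStep p :: q := by
  rcases p with _ | ⟨c, p⟩
  · simp
  · intro h
    exact c.other_ne (List.cons.inj h).1.symm

open scoped Classical in
/-- The kind of the line through `p` on whose side the point `y ≠ p` lies. -/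
def side (p y : L.Point) : PedigreeStep :=
  if freeStep p.1 :: p.1 <:+ y.1 then freeStep p.1 else (freeStep p.1).other

theorem side_congr {p y z : L.Point}
    (h : freeStep p.1 :: p.1 <:+ y.1 ↔ freeStep p.1 :: p.1 <:+ z.1) : side p y = side p z := by
  simp only [side, h]

theorem side_eq_of_iff {p y : L.Point} {c : PedigreeStep}
    (h : freeStep p.1 :: p.1 <:+ y.1 ↔ freeStep p.1 = c) : side p y = c := by
  unfold side
  split_ifs with h1
  · exact h.1 h1
  · exact PedigreeStep.other_eq_of_ne fun h2 => h1 (h.2 h2)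

/-- Only the branch above `freeStep p :: p` is attached to `p` by the line having `p` as its foot;
everything else is attached by the other line. A genuine step enters this branch only from `p`, and
a wrap-around can leave it only by landing on `p` or below, which `hy'` and the choice of the letter
prevent. -/
theorem side_climb {p y : L.Point} {c : PedigreeStep} (hy : y ≠ p) (hy' : L.climb c y ≠ p) :
    side p (L.climb c y) = side p y := by
  refine side_congr ?_
  by_cases h : c :: y.1 ∈ L.points
  · rw [climb_of_mem h, List.suffix_cons_iff]
    refine or_iff_right fun h' => hy ?_
    exact Subtype.ext (List.cons.inj h').2.symm
  · obtain ⟨n, hn⟩ := exists_eq_replicate_append_stripLead c y.1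
    have hz := climb_of_notMem h
    rw [hz]
    refine ⟨fun h' => h'.trans (stripLead_suffix c y.1), fun h' => ?_⟩
    rw [hn] at h'
    refine List.cons_suffix_of_suffix_replicate_append (ne_freeStep_cons _) ?_ h'
    exact fun h'' => hy' (Subtype.ext (hz.trans h''))

theorem side_climb_self {p : L.Point} {c : PedigreeStep} (hp : L.climb c p ≠ p) :
    side p (L.climb c p) = c := by
  refine side_eq_of_iff ?_
  by_cases h : c :: p.1 ∈ L.points
  · rw [climb_of_mem h]
    constructor
    · intro h'
      rw [List.suffix_cons_iff] at h'
      rcases h' with h' | h'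
      · exact (List.cons.inj h').1
      · exact absurd h'.length_le (by simp)
    · intro h'
      rw [h']
  · have hz := climb_of_notMem h
    have hlen := (stripLead_suffix c p.1).length_le
    rw [hz]
    constructor
    · intro h'
      have := h'.length_le
      simp only [List.length_cons] at this
      omega
    · intro h'
      -- If `freeStep p.1` were `c`, then `p` would be the foot of its `c`-line and the wrap-around
      -- would fix it.
      refine absurd (Subtype.ext (hz.trans ?_)) hp
      rcases hp1 : p.1 with _ | ⟨d, q⟩
      · rfl
      · refine stripLead_cons_of_ne ?_ q
        rintro rfl
        exact ne_freeStep_cons p.1 q (by rw [h', hp1])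

theorem side_of_climb_eq {p y : L.Point} {c : PedigreeStep} (h : L.climb c y = p) (hy : y ≠ p) :
    side p y = c := by
  refine side_eq_of_iff ?_
  by_cases hc : c :: y.1 ∈ L.points
  · rw [climb_of_mem hc] at h
    subst h
    constructor
    · intro h'
      have := h'.length_le
      simp only [List.length_cons] at this
      omega
    · intro h'
      exact absurd (congrArg (· :: y.1) h'.symm) (ne_freeStep_cons _ _)
  · obtain ⟨n, hn⟩ := exists_eq_replicate_append_stripLead c y.1
    rw [← climb_of_notMem hc, h] at hn
    rw [hn]
    refine ⟨List.eq_of_cons_suffix_replicate_append, fun h' => ?_⟩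
    rw [h']
    refine List.cons_suffix_replicate_append ?_ _
    rintro rfl
    exact hy (Subtype.ext hn)

theorem side_next {p y : L.Point} {c : PedigreeStep} (hy : y ≠ p) (hy' : L.next c y ≠ p) :
    side p (L.next c y) = side p y := by
  cases c
  · exact side_climb hy hy'
  · have h := side_climb (c := .betaInv) hy' (by rwa [climb_next_betaInv])
    rw [climb_next_betaInv] at h
    exact h.symm

theorem side_next_self {p : L.Point} {c : PedigreeStep} (hp : L.next c p ≠ p) :
    side p (L.next c p) = c := by
  cases c
  · exact side_climb_self hp
  · exact side_of_climb_eq (climb_next_betaInv p) hp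

theorem side_of_next_eq {p y : L.Point} {c : PedigreeStep} (h : L.next c y = p) (hy : y ≠ p) :
    side p y = c := by
  cases c
  · exact side_of_climb_eq h hy
  · have h' : L.climb .betaInv p = y := by rw [← h, climb_next_betaInv]
    rw [← h']
    exact side_climb_self (by rwa [h'])

theorem side_iterate_next {p : L.Point} {c : PedigreeStep} {n : ℕ}
    (h : (L.next c)^[n] p ≠ p) : side p ((L.next c)^[n] p) = c := by
  induction n with
  | zero => exact absurd rfl h
  | succ n ih =>
    rw [Function.iterate_succ_apply'] at h ⊢
    by_cases hp : (L.next c)^[n] p = p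
    · rw [hp] at h ⊢
      exact side_next_self h
    · rw [side_next hp h, ih hp]

/-! ### The Brauer-quiver of a pedigree -/

variable (L)

/-- The points of a pedigree, as the points of the quiver obtained by closing up its lines. -/
def ClosedPoint : Type := L.Point

instance : Fintype L.ClosedPoint := inferInstanceAs (Fintype L.Point)

instance : Quiver.{0} L.ClosedPoint := ⟨fun x y => {c : PedigreeStep // L.next c x = y}⟩

variable {L}

/-- The arrow from `x` to the next point of a line. -/
def closedArrow (c : PedigreeStep) (x : L.Point) : Quiver.Total L.ClosedPoint :=
  ⟨x, L.next c x, ⟨c, rfl⟩⟩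

/-- The arrows of the quiver obtained by closing up the lines of a pedigree. -/
def closedArrowEquiv : PedigreeStep × L.Point ≃ Quiver.Total L.ClosedPoint where
  toFun p := closedArrow p.1 p.2
  invFun a := (a.hom.1, a.left)
  left_inv _ := rfl
  right_inv := by
    rintro ⟨x, y, c, rfl⟩
    rfl

theorem exists_eq_closedArrow (a : Quiver.Total L.ClosedPoint) :
    ∃ c, a = closedArrow c a.left := ⟨a.hom.1, (closedArrowEquiv.apply_symm_apply a).symm⟩

theorem side_eq_of_isChain {p : L.Point} {d : PedigreeStep} {a : Quiver.Total L.ClosedPoint}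
    {l : List (Quiver.Total L.ClosedPoint)}
    (h : (a :: l).IsChain fun a b => a.right = b.left) (hl : ∀ b ∈ l, b.left ≠ p)
    (ha : a.right ≠ p → side p a.right = d) : ∀ b ∈ l, side p b.left = d := by
  induction l generalizing a with
  | nil => simp
  | cons b l ih =>
    obtain ⟨hab, hch⟩ := List.isChain_cons_cons.1 h
    have hb := hl b (by simp)
    rw [hab] at ha
    intro b' hb'
    rcases List.mem_cons.1 hb' with rfl | hb'
    · exact ha hb
    · refine ih hch (fun b hb => hl b (List.mem_cons_of_mem _ hb)) (fun hr => ?_) b' hb'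
      obtain ⟨c, hc⟩ := exists_eq_closedArrow b
      rw [← ha hb]
      rw [hc] at hr ⊢
      exact side_next hb hr

variable (L) in
/-- A pedigree describes the quiver obtained by closing up its lines. -/
def closedModel : PedigreeModel L L.ClosedPoint where
  point := Equiv.refl _
  arrow := closedArrowEquiv
  left _ _ := rfl
  right _ _ := rfl
  closed Z hZ c x hx := by
    obtain ⟨b, hb, hbl⟩ := hZ.exists_next hx
    obtain ⟨d, hd⟩ := exists_eq_closedArrow b
    rw [hbl] at hd
    change closedArrow c x ∈ Z at hx
    change closedArrow c (L.next c x) ∈ Z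
    change b = closedArrow d (L.next c x) at hd
    subst hd
    suffices h : d = c by
      subst h
      exact hb
    -- Rotate the cycle so that it starts with the arrow leaving `L.next c x`. The rest avoids that
    -- point and so stays on its side `d`; unless the arrow from `x` is this first arrow, it belongs
    -- to the rest, and `x` lies on side `c`.
    obtain ⟨l, rfl⟩ := Cycle.exists_cons_eq hb
    rcases List.mem_cons.1 (Cycle.mem_coe_iff.1 hx) with h | h
    · exact congrArg (fun a => (closedArrowEquiv.symm a).1) h.symm
    · have hl : ∀ b ∈ l, b.left ≠ L.next c x := by
        intro b hb' hbl
        have hnd := hZ.nodup_cons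
        rw [List.map_cons, List.nodup_cons] at hnd
        exact hnd.1 (List.mem_map.2 ⟨b, hb', hbl⟩)
      have hch := hZ.isChain
      rw [← List.cons_append] at hch
      rw [← side_of_next_eq rfl (hl _ h)]
      exact (side_eq_of_isChain (List.isChain_append.1 hch).1 hl
        (fun h => side_next_self h) _ h).symm

theorem eqvGen_root (x : L.ClosedPoint) :
    Relation.EqvGen (fun a b : L.ClosedPoint => Nonempty (a ⟶ b)) x ⟨[], L.root_mem⟩ := by
  obtain ⟨x, hx⟩ := x
  induction x with
  | nil => exact .refl _
  | cons c x ih =>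
    have hx' := L.parent_mem c x hx
    refine .trans _ _ _ ?_ (ih hx')
    cases c
    · exact .symm _ _ (.rel _ _ ⟨⟨.alpha, climb_of_mem (x := ⟨x, hx'⟩) hx⟩⟩)
    · exact .rel _ _ ⟨⟨.betaInv, next_betaInv_of_mem (x := ⟨x, hx'⟩) hx⟩⟩

theorem eq_lineCycle {Z : Cycle (Quiver.Total L.ClosedPoint)} (hZ : IsQuiverCycle Z)
    {x : L.ClosedPoint} (hx : x ∈ Z.map Quiver.Total.left) :
    ∃ c, Z = L.closedModel.lineCycle c x := by
  obtain ⟨a, ha, rfl⟩ := Cycle.mem_map.1 hx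
  obtain ⟨c, hc⟩ := exists_eq_closedArrow a
  refine ⟨c, L.closedModel.eq_lineCycle hZ ?_⟩
  rw [hc] at ha
  exact ha

theorem exists_iterate_eq {c : PedigreeStep} {x y : L.ClosedPoint}
    (h : y ∈ (L.closedModel.lineCycle c x).map Quiver.Total.left) :
    ∃ n, (L.next c)^[n] x = y := by
  obtain ⟨a, ha, rfl⟩ := Cycle.mem_map.1 h
  obtain ⟨n, rfl⟩ := L.closedModel.exists_eq_of_mem_lineCycle ha
  exact ⟨n, rfl⟩

theorem self_mem_lineCycle (c : PedigreeStep) (x : L.ClosedPoint) :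
    x ∈ (L.closedModel.lineCycle c x).map Quiver.Total.left :=
  Cycle.mem_map.2 ⟨_, L.closedModel.arrow_mem_lineCycle c x, rfl⟩

theorem lineCycle_ne (x : L.ClosedPoint) :
    L.closedModel.lineCycle .alpha x ≠ L.closedModel.lineCycle .betaInv x := by
  intro h
  have h1 := L.closedModel.arrow_mem_lineCycle .alpha x
  rw [h] at h1
  obtain ⟨n, hn⟩ := L.closedModel.exists_eq_of_mem_lineCycle h1
  exact absurd (congrArg Prod.fst (L.closedModel.arrow.injective hn)) (by simp)

variable (L) in
/-- The Brauer-quiver obtained by closing up the lines of a pedigree. -/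
def brauerQuiver : BrauerQuiver.{0, 0} where
  Point := L.ClosedPoint
  finite_arrows := Finite.of_equiv _ L.closedModel.arrow
  nonempty := ⟨⟨[], L.root_mem⟩⟩
  connected x y := .trans _ _ _ (eqvGen_root x) (.symm _ _ (eqvGen_root y))
  arrow_mem_cycle a := by
    obtain ⟨⟨c, x⟩, rfl⟩ := L.closedModel.arrow.surjective a
    exact ⟨_, L.closedModel.isQuiverCycle_lineCycle c x, L.closedModel.arrow_mem_lineCycle c x⟩
  two_cycles x := by
    have h : {Z : Cycle (Quiver.Total L.ClosedPoint) |
        IsQuiverCycle Z ∧ x ∈ Z.map Quiver.Total.left} =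
        {L.closedModel.lineCycle .alpha x, L.closedModel.lineCycle .betaInv x} := by
      ext Z
      simp only [Set.mem_ofPred_eq, Set.mem_insert_iff, Set.mem_singleton_iff]
      constructor
      · rintro ⟨hZ, hx⟩
        obtain ⟨c, rfl⟩ := eq_lineCycle hZ hx
        cases c
        · exact Or.inl rfl
        · exact Or.inr rfl
      · rintro (rfl | rfl) <;>
          exact ⟨L.closedModel.isQuiverCycle_lineCycle _ x, self_mem_lineCycle _ x⟩
    rw [h, Set.ncard_pair (lineCycle_ne x)]
  meet Z Z' hZ hZ' hne x y hx hx' hy hy' := by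
    obtain ⟨c, rfl⟩ := eq_lineCycle hZ hx
    obtain ⟨d, rfl⟩ := eq_lineCycle hZ' hx'
    obtain ⟨m, hm⟩ := exists_iterate_eq hy
    obtain ⟨n, hn⟩ := exists_iterate_eq hy'
    -- A second common point would lie both on side `c` and on side `d` of `x`, so the two lines
    -- would coincide.
    by_contra hxy
    have h1 := side_iterate_next (p := x) (c := c) (n := m) (by rw [hm]; exact Ne.symm hxy)
    have h2 := side_iterate_next (p := x) (c := d) (n := n) (by rw [hn]; exact Ne.symm hxy)
    rw [hm] at h1
    rw [hn] at h2
    exact hne (by rw [← h1, ← h2])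

variable (L) in
/-- A pedigree describes its Brauer-quiver. -/
def brauerQuiverModel : PedigreeModel L L.brauerQuiver.Point := L.closedModel

end Pedigree

namespace BrauerQuiver

variable {Q : BrauerQuiver.{u, v}}

/-! ### The successor of an arrow -/

theorem eq_singleton_of_loop {V : Type u} [Quiver.{v} V] {Z : Cycle (Quiver.Total V)}
    (hZ : IsQuiverCycle Z) {a : Quiver.Total V} (ha : a ∈ Z) (h : a.left = a.right) :
    Z = ↑[a] := by
  obtain ⟨l, rfl⟩ := Cycle.exists_cons_eq ha
  rcases l with _ | ⟨b, l⟩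
  · rfl
  · have h1 := (List.isChain_cons_cons.1 hZ.isChain).1
    have h2 := hZ.nodup_cons
    rw [List.map_cons, List.nodup_cons] at h2
    exact absurd (List.mem_map.2 ⟨b, by simp, (h.trans h1).symm⟩) h2.1

/-- Different cycles sharing an arrow would share both its ends. By `meet` the arrow would then be a
loop, and a cycle containing a loop consists of that loop only. -/
theorem cycle_unique {a : Quiver.Total Q.Point} {Z Z' : Cycle (Quiver.Total Q.Point)}
    (hZ : IsQuiverCycle Z) (hZ' : IsQuiverCycle Z') (ha : a ∈ Z) (ha' : a ∈ Z') : Z = Z' := by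
  by_contra hne
  obtain ⟨b, hb, hba⟩ := hZ.exists_next ha
  obtain ⟨b', hb', hba'⟩ := hZ'.exists_next ha'
  have h := Q.meet Z Z' hZ hZ' hne a.left a.right (Cycle.mem_map.2 ⟨a, ha, rfl⟩)
    (Cycle.mem_map.2 ⟨a, ha', rfl⟩) (Cycle.mem_map.2 ⟨b, hb, hba⟩)
    (Cycle.mem_map.2 ⟨b', hb', hba'⟩)
  exact hne ((eq_singleton_of_loop hZ ha h).trans (eq_singleton_of_loop hZ' ha' h).symm)

instance : Finite (Quiver.Total Q.Point) := Q.finite_arrows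

theorem exists_nextArrow (a : Quiver.Total Q.Point) : ∃ b : Quiver.Total Q.Point,
    b.left = a.right ∧ ∀ Z : Cycle (Quiver.Total Q.Point), IsQuiverCycle Z → a ∈ Z → b ∈ Z := by
  obtain ⟨Z, hZ, ha⟩ := Q.arrow_mem_cycle a
  obtain ⟨b, hb, h⟩ := hZ.exists_next ha
  exact ⟨b, h, fun Z' hZ' ha' => cycle_unique hZ hZ' ha ha' ▸ hb⟩

theorem nextArrow_surjective :
    Function.Surjective fun a : Quiver.Total Q.Point => (exists_nextArrow a).choose := by
  intro b
  obtain ⟨Z, hZ, hb⟩ := Q.arrow_mem_cycle b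
  obtain ⟨a, ha, h⟩ := hZ.exists_prev hb
  obtain ⟨h1, h2⟩ := (exists_nextArrow a).choose_spec
  exact ⟨a, hZ.eq_of_left_eq (h2 Z hZ ha) hb (h1.trans h)⟩

variable (Q) in
/-- The permutation of the arrows that takes an arrow to the next arrow of its cycle. -/
def nextArrow : Equiv.Perm (Quiver.Total Q.Point) :=
  Equiv.ofBijective _ (Finite.surjective_iff_bijective.1 (nextArrow_surjective (Q := Q)))

theorem nextArrow_left (a : Quiver.Total Q.Point) : (Q.nextArrow a).left = a.right :=
  (exists_nextArrow a).choose_spec.1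

theorem nextArrow_mem {a : Quiver.Total Q.Point} {Z : Cycle (Quiver.Total Q.Point)}
    (hZ : IsQuiverCycle Z) (ha : a ∈ Z) : Q.nextArrow a ∈ Z :=
  (exists_nextArrow a).choose_spec.2 Z hZ ha

theorem mem_of_sameCycle {a b : Quiver.Total Q.Point} (h : Q.nextArrow.SameCycle a b)
    {Z : Cycle (Quiver.Total Q.Point)} (hZ : IsQuiverCycle Z) (ha : a ∈ Z) : b ∈ Z := by
  obtain ⟨n, rfl⟩ := h.exists_nat_pow_eq
  clear h
  induction n with
  | zero => exact ha
  | succ n ih => rw [pow_succ', Equiv.Perm.mul_apply]; exact nextArrow_mem hZ ih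

theorem sameCycle_of_mem {a b : Quiver.Total Q.Point} {Z : Cycle (Quiver.Total Q.Point)}
    (hZ : IsQuiverCycle Z) (ha : a ∈ Z) (hb : b ∈ Z) : Q.nextArrow.SameCycle a b := by
  obtain ⟨l, rfl⟩ := Cycle.exists_cons_eq ha
  have h := hZ.cons_eq_map_iterate nextArrow_left fun b hb => nextArrow_mem hZ hb
  rw [Cycle.mem_coe_iff, h, List.mem_map] at hb
  obtain ⟨n, -, rfl⟩ := hb
  rw [← Equiv.Perm.coe_pow, Equiv.Perm.sameCycle_pow_right]

theorem eq_of_sameCycle {a b : Quiver.Total Q.Point} (h : Q.nextArrow.SameCycle a b)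
    (hab : a.left = b.left) : a = b := by
  obtain ⟨Z, hZ, ha⟩ := Q.arrow_mem_cycle a
  exact hZ.eq_of_left_eq ha (mem_of_sameCycle h hZ ha) hab

/-! ### The two arrows starting in a point -/

/-- Each of the two cycles through the point contains exactly one arrow starting there, every arrow
lies in a cycle, and no arrow lies in both. -/
theorem exists_otherArrow (a : Quiver.Total Q.Point) : ∃ b : Quiver.Total Q.Point,
    b ≠ a ∧ b.left = a.left ∧ ∀ c : Quiver.Total Q.Point, c.left = a.left → c = a ∨ c = b := by
  obtain ⟨Z, hZ, ha⟩ := Q.arrow_mem_cycle a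
  obtain ⟨Z₁, Z₂, hne, hset⟩ := Set.ncard_eq_two.1 (Q.two_cycles a.left)
  have hiff : ∀ W : Cycle (Quiver.Total Q.Point),
      (IsQuiverCycle W ∧ a.left ∈ W.map Quiver.Total.left) ↔ W = Z₁ ∨ W = Z₂ := fun W =>
    Set.ext_iff.1 hset W
  obtain ⟨Z', hZZ', hZ'⟩ : ∃ Z', Z' ≠ Z ∧ ∀ W : Cycle (Quiver.Total Q.Point),
      (IsQuiverCycle W ∧ a.left ∈ W.map Quiver.Total.left) ↔ W = Z ∨ W = Z' := by
    rcases (hiff Z).1 ⟨hZ, Cycle.mem_map.2 ⟨a, ha, rfl⟩⟩ with rfl | rfl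
    · exact ⟨Z₂, hne.symm, hiff⟩
    · exact ⟨Z₁, hne, fun W => (hiff W).trans or_comm⟩
  obtain ⟨hc', hm'⟩ := (hZ' Z').2 (Or.inr rfl)
  obtain ⟨b, hb, hba⟩ := Cycle.mem_map.1 hm'
  refine ⟨b, ?_, hba, fun c hc => ?_⟩
  · rintro rfl
    exact hZZ' (cycle_unique hc' hZ hb ha)
  · obtain ⟨W, hW, hcW⟩ := Q.arrow_mem_cycle c
    rcases (hZ' W).1 ⟨hW, Cycle.mem_map.2 ⟨c, hcW, hc⟩⟩ with rfl | rfl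
    · exact Or.inl (hZ.eq_of_left_eq hcW ha hc)
    · exact Or.inr (hc'.eq_of_left_eq hcW hb (hc.trans hba.symm))

/-- The other arrow with the same starting point. -/
def otherArrow (a : Quiver.Total Q.Point) : Quiver.Total Q.Point := (exists_otherArrow a).choose

theorem otherArrow_ne (a : Quiver.Total Q.Point) : otherArrow a ≠ a :=
  (exists_otherArrow a).choose_spec.1

@[simp]
theorem otherArrow_left (a : Quiver.Total Q.Point) : (otherArrow a).left = a.left :=
  (exists_otherArrow a).choose_spec.2.1

theorem eq_or_eq_otherArrow {a c : Quiver.Total Q.Point} (h : c.left = a.left) :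
    c = a ∨ c = otherArrow a :=
  (exists_otherArrow a).choose_spec.2.2 c h

@[simp]
theorem otherArrow_otherArrow (a : Quiver.Total Q.Point) : otherArrow (otherArrow a) = a := by
  rcases eq_or_eq_otherArrow (a := a) (c := otherArrow (otherArrow a)) (by simp) with h | h
  · exact h
  · exact absurd h (otherArrow_ne _)

/-! ### Points of a Brauer-quiver are cut points -/

/-- The relation given by the arrows that avoid a point. -/
def AvoidStep (x y z : Q.Point) : Prop := y ≠ x ∧ z ≠ x ∧ Nonempty (y ⟶ z)

/-- There is a path from the end of `e` to `y` that avoids the starting point of `e`. -/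
def Reach (e : Quiver.Total Q.Point) (y : Q.Point) : Prop :=
  e.right ≠ e.left ∧ Relation.ReflTransGen (AvoidStep e.left) e.right y

theorem Reach.ne {e : Quiver.Total Q.Point} {y : Q.Point} (h : Reach e y) : y ≠ e.left := by
  rcases Relation.ReflTransGen.cases_tail h.2 with h' | ⟨z, -, h'⟩
  · rw [h']
    exact h.1
  · exact h'.2.1

theorem Reach.step {e a : Quiver.Total Q.Point} (h : Reach e a.left) (ha : a.right ≠ e.left) :
    Reach e a.right :=
  ⟨h.1, h.2.tail ⟨h.ne, ha, ⟨a.hom⟩⟩⟩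

/-- Points are added in front; if the new point already occurs, the path is shortened to its part
from that occurrence on. The last arrow `g` is kept as a suffix so that the path can be closed up
later. -/
theorem exists_simple_path {x : Q.Point} {g : Quiver.Total Q.Point} (hg : g.left ≠ x)
    {y : Q.Point} (h : Relation.ReflTransGen (AvoidStep x) y g.left) :
    ∃ (a : Quiver.Total Q.Point) (l : List (Quiver.Total Q.Point)),
      (a :: l).IsChain (fun a b => a.right = b.left) ∧ a.left = y ∧ [g] <:+ a :: l ∧
      ((a :: l).map Quiver.Total.left).Nodup ∧ ∀ b ∈ a :: l, b.left ≠ x := by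
  induction h using Relation.ReflTransGen.head_induction_on with
  | refl => exact ⟨g, [], by simp, rfl, List.suffix_rfl, by simp, by simpa using hg⟩
  | @head y z hyz _ ih =>
    obtain ⟨a, l, hch, rfl, hlast, hnd, hx⟩ := ih
    obtain ⟨hyx, -, ⟨r⟩⟩ := hyz
    by_cases hy : y ∈ (a :: l).map Quiver.Total.left
    · obtain ⟨b, hb, rfl⟩ := List.mem_map.1 hy
      obtain ⟨l₁, l₂, hl⟩ := List.append_of_mem hb
      have hsuf : b :: l₂ <:+ a :: l := ⟨l₁, hl.symm⟩
      refine ⟨b, l₂, ?_, rfl, ?_, ?_, fun b' hb' => hx b' (hsuf.subset hb')⟩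
      · rw [hl] at hch
        exact (List.isChain_append.1 hch).2.1
      · exact List.suffix_of_suffix_length_le hlast hsuf (by simp)
      · exact hnd.sublist (hsuf.sublist.map _)
    · refine ⟨⟨y, a.left, r⟩, a :: l, List.isChain_cons_cons.2 ⟨rfl, hch⟩, rfl,
        hlast.trans (List.suffix_cons _ _), ?_, ?_⟩
      · rw [List.map_cons, List.nodup_cons]
        exact ⟨hy, hnd⟩
      · intro b hb
        rcases List.mem_cons.1 hb with rfl | hb
        · exact hyx
        · exact hx b hb

/-- A simple path from the end of `e` through `g`, avoiding the start of `e` before its last arrow,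
is completed by `e` to a cycle. Thus every such return to the start of `e` runs along the cycle of
`e`. -/
theorem Reach.sameCycle {e g : Quiver.Total Q.Point} (h : Reach e g.left)
    (hg : g.right = e.left) : Q.nextArrow.SameCycle e g := by
  obtain ⟨a, l, hch, ha, ⟨t, ht⟩, hnd, hx⟩ := exists_simple_path h.ne h.2
  have hZ : IsQuiverCycle (↑(e :: a :: l) : Cycle (Quiver.Total Q.Point)) := by
    refine ⟨by simp, ?_, ?_⟩
    · rw [Cycle.chain_coe_cons, List.cons_append, List.isChain_cons_cons]
      refine ⟨ha.symm, ?_⟩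
      rw [← List.cons_append, List.isChain_append]
      refine ⟨hch, by simp, ?_⟩
      rw [← ht]
      simpa using hg
    · rw [Cycle.map_coe, Cycle.nodup_coe_iff, List.map_cons, List.nodup_cons]
      refine ⟨fun h' => ?_, hnd⟩
      obtain ⟨b, hb, hbe⟩ := List.mem_map.1 h'
      exact hx b hb hbe
  refine sameCycle_of_mem hZ (by simp) ?_
  rw [Cycle.mem_coe_iff, ← ht]
  simp

theorem reach_of_sameCycle {e a : Quiver.Total Q.Point} (h : Q.nextArrow.SameCycle e a)
    (ha : a.left ≠ e.left) : Reach e a.left := by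
  obtain ⟨n, rfl⟩ := h.exists_nat_pow_eq
  clear h
  induction n with
  | zero => exact absurd rfl ha
  | succ n ih =>
    rw [pow_succ', Equiv.Perm.mul_apply, nextArrow_left] at ha ⊢
    by_cases h : ((Q.nextArrow ^ n) e).left = e.left
    · have : e = (Q.nextArrow ^ n) e :=
        eq_of_sameCycle (Equiv.Perm.sameCycle_pow_right.2 .rfl) h.symm
      rw [← this] at ha ⊢
      exact ⟨ha, .refl⟩
    · exact (ih h).step ha

theorem Reach.pow {e a : Quiver.Total Q.Point} (h : Reach e a.left)
    (hea : ¬ Q.nextArrow.SameCycle e a) (n : ℕ) : Reach e ((Q.nextArrow ^ n) a).left := by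
  induction n with
  | zero => exact h
  | succ n ih =>
    rw [pow_succ', Equiv.Perm.mul_apply, nextArrow_left]
    exact ih.step fun h' => hea (Equiv.Perm.sameCycle_pow_right.1 (ih.sameCycle h'))

/-- From a reached point on the other cycle one could follow that cycle back to `otherArrow e`; by
`Reach.pow` its starting point, which is that of `e`, would be reached as well. -/
theorem not_reach_of_sameCycle {e a : Quiver.Total Q.Point}
    (h : Q.nextArrow.SameCycle (otherArrow e) a) : ¬ Reach e a.left := by
  intro hr
  have hea : ¬ Q.nextArrow.SameCycle e a := fun h' =>
    otherArrow_ne e (eq_of_sameCycle (h.trans h'.symm) (otherArrow_left e))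
  obtain ⟨n, hn⟩ := h.symm.exists_nat_pow_eq
  have h1 := hr.pow hea n
  rw [hn] at h1
  exact h1.ne (otherArrow_left e)

/-- To go backwards along `a`, run around the rest of its cycle. This avoids the start of `e` unless
`a` lies on the cycle of `e`, whose other points are all reached anyway. -/
theorem reach_left_iff_right {e a : Quiver.Total Q.Point} (hl : a.left ≠ e.left)
    (hr : a.right ≠ e.left) : Reach e a.left ↔ Reach e a.right := by
  refine ⟨fun h => h.step hr, fun h => ?_⟩
  by_cases hea : Q.nextArrow.SameCycle e a
  · exact reach_of_sameCycle hea hl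
  · rw [← nextArrow_left] at h
    obtain ⟨n, hn⟩ := (Equiv.Perm.sameCycle_apply_left.2
      (Equiv.Perm.SameCycle.refl Q.nextArrow a)).exists_nat_pow_eq
    have := h.pow (fun h' => hea (Equiv.Perm.sameCycle_apply_right.1 h')) n
    rwa [hn] at this

/-! ### Walks in a Brauer-quiver -/

variable (Q) in
/-- `otherArrow` as a permutation. -/
def otherPerm : Equiv.Perm (Quiver.Total Q.Point) :=
  Function.Involutive.toPerm otherArrow otherArrow_otherArrow

variable (Q) in
/-- If an arrow is of the kind `α`, then `Q.turn c` takes it to the arrow of the kind `α` whose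
starting point is reached by a step of the kind `c`. -/
def turn : PedigreeStep → Equiv.Perm (Quiver.Total Q.Point)
  | .alpha => Q.nextArrow
  | .betaInv => Q.otherPerm * Q.nextArrow⁻¹ * Q.otherPerm⁻¹

theorem nextArrow_other_turn (a : Quiver.Total Q.Point) :
    Q.nextArrow (otherArrow (Q.turn .betaInv a)) = otherArrow a := by
  change Q.nextArrow (otherArrow (otherArrow (Q.nextArrow⁻¹ (otherArrow a)))) = _
  rw [otherArrow_otherArrow]
  exact Q.nextArrow.apply_symm_apply _

/-- For `betaInv`, undoing the conjugation and the inversion reduces the claim to an orbit of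
`nextArrow`. -/
theorem eq_of_sameCycle_turn {c : PedigreeStep} {a b : Quiver.Total Q.Point}
    (h : (Q.turn c).SameCycle a b) (hab : a.left = b.left) : a = b := by
  cases c
  · exact eq_of_sameCycle h hab
  · have h' := Equiv.Perm.sameCycle_inv.1 (Equiv.Perm.sameCycle_conj.1 h)
    exact Q.otherPerm⁻¹.injective (eq_of_sameCycle h'
      ((otherArrow_left a).trans (hab.trans (otherArrow_left b).symm)))

open scoped Classical in
/-- The side of the starting point of `e` on which a point lies. -/
def side (e : Quiver.Total Q.Point) (y : Q.Point) : PedigreeStep :=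
  if Reach e y then .alpha else .betaInv

theorem side_congr {e : Quiver.Total Q.Point} {y z : Q.Point} (h : Reach e y ↔ Reach e z) :
    side e y = side e z := by
  by_cases hy : Reach e y
  · rw [side, side, if_pos hy, if_pos (h.1 hy)]
  · rw [side, side, if_neg hy, if_neg (mt h.2 hy)]

theorem side_turn {e a : Quiver.Total Q.Point} {c : PedigreeStep} (ha : a.left ≠ e.left)
    (ha' : (Q.turn c a).left ≠ e.left) : side e (Q.turn c a).left = side e a.left := by
  refine side_congr ?_
  cases c
  · change (Q.nextArrow a).left ≠ _ at ha'
    change Reach e (Q.nextArrow a).left ↔ _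
    rw [nextArrow_left] at ha' ⊢
    exact (reach_left_iff_right ha ha').symm
  · have h := nextArrow_left (otherArrow (Q.turn .betaInv a))
    rw [nextArrow_other_turn, otherArrow_left] at h
    have := reach_left_iff_right (e := e) (a := otherArrow (Q.turn .betaInv a))
      (by rwa [otherArrow_left]) (by rwa [← h])
    rwa [← h, otherArrow_left] at this

theorem side_of_sameCycle {e a : Quiver.Total Q.Point} {c : PedigreeStep}
    (h : (Q.turn c).SameCycle e a) (ha : a.left ≠ e.left) : side e a.left = c := by
  cases c
  · exact if_pos (reach_of_sameCycle h ha)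
  · refine if_neg ?_
    have h' := Equiv.Perm.sameCycle_inv.1 (Equiv.Perm.sameCycle_conj.1 h)
    have := not_reach_of_sameCycle (e := e) (a := otherArrow a) h'
    rwa [otherArrow_left] at this

/-- The walk from `e` along a word. -/
def walk (e : Quiver.Total Q.Point) : List PedigreeStep → Quiver.Total Q.Point
  | [] => e
  | c :: x => Q.turn c (walk e x)

variable (e : Quiver.Total Q.Point)

theorem walk_cons (c : PedigreeStep) (x : List PedigreeStep) :
    walk e (c :: x) = Q.turn c (walk e x) := rfl

theorem walk_replicate_append (n : ℕ) (c : PedigreeStep) (x : List PedigreeStep) :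
    walk e (List.replicate n c ++ x) = (Q.turn c ^ n) (walk e x) := by
  induction n with
  | zero => rfl
  | succ n ih =>
    rw [List.replicate_succ, List.cons_append, walk_cons, ih, pow_succ', Equiv.Perm.mul_apply]

/-- The walk along a word visits no point twice. -/
def IsSimple (x : List PedigreeStep) : Prop :=
  ∀ y z, y <:+ x → z <:+ x → (walk e y).left = (walk e z).left → y = z

variable {e}

theorem IsSimple.of_suffix {x y : List PedigreeStep} (hx : IsSimple e x) (h : y <:+ x) :
    IsSimple e y := fun _ _ h1 h2 => hx _ _ (h1.trans h) (h2.trans h)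

theorem isSimple_nil : IsSimple e [] := by
  intro y z hy hz _
  rw [List.suffix_nil.1 hy, List.suffix_nil.1 hz]

theorem IsSimple.exists_of_not_cons {c : PedigreeStep} {x : List PedigreeStep}
    (hx : IsSimple e x) (h : ¬ IsSimple e (c :: x)) :
    ∃ y, y <:+ x ∧ (walk e (c :: x)).left = (walk e y).left := by
  by_contra! hne
  refine h fun y z hy hz hyz => ?_
  rw [List.suffix_cons_iff] at hy hz
  rcases hy with rfl | hy <;> rcases hz with rfl | hz
  · rfl
  · exact absurd hyz (hne z hz)
  · exact absurd hyz.symm (hne y hy)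
  · exact hx y z hy hz hyz

theorem side_walk_append {a : Quiver.Total Q.Point} {x y : List PedigreeStep}
    (h : ∀ z, z <:+ x → (walk e (z ++ y)).left ≠ a.left) :
    side a (walk e (x ++ y)).left = side a (walk e y).left := by
  induction x with
  | nil => rfl
  | cons c x ih =>
    rw [List.cons_append, walk_cons, side_turn (h x (List.suffix_cons c x)),
      ih fun z hz => h z (hz.trans (List.suffix_cons c x))]
    exact h (c :: x) List.suffix_rfl

theorem IsSimple.left_ne {x y z : List PedigreeStep} (hx : IsSimple e x) (hy : y <:+ x)
    (hz : z <:+ x) (h : y ≠ z) : (walk e y).left ≠ (walk e z).left := fun h' =>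
  h (hx y z hy hz h')

/-- Words are read from the right: the step `c` leaves the end of `y` to side `c`, and the remaining
steps never return to that point, so they cannot change the side. -/
theorem IsSimple.side_eq {x y : List PedigreeStep} {c : PedigreeStep}
    (h : IsSimple e (x ++ c :: y)) : side (walk e y) (walk e (x ++ c :: y)).left = c := by
  have hne : ∀ z, z <:+ x → (walk e (z ++ c :: y)).left ≠ (walk e y).left := by
    intro z hz
    refine h.left_ne ?_ ⟨x ++ [c], by simp⟩ fun h' => ?_
    · obtain ⟨t, rfl⟩ := hz
      exact ⟨t, by simp⟩
    · have := congrArg List.length h'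
      simp at this
      omega
  rw [side_walk_append hne]
  refine side_of_sameCycle ?_ (hne [] (List.nil_suffix))
  rw [walk_cons]
  exact Equiv.Perm.sameCycle_apply_right.2 .rfl

theorem _root_.List.prefix_or_prefix_or_exists_ne {α : Type*} (x y : List α) :
    x <+: y ∨ y <+: x ∨ ∃ z c d x' y', c ≠ d ∧ x = z ++ c :: x' ∧ y = z ++ d :: y' := by
  induction x generalizing y with
  | nil => exact Or.inl ⟨_, rfl⟩
  | cons c x ih =>
    rcases y with _ | ⟨d, y⟩
    · exact Or.inr (Or.inl ⟨_, rfl⟩)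
    · by_cases h : c = d
      · subst h
        rcases ih y with h | h | ⟨z, c', d', x', y', hne, rfl, rfl⟩
        · exact Or.inl (List.cons_prefix_cons.2 ⟨rfl, h⟩)
        · exact Or.inr (Or.inl (List.cons_prefix_cons.2 ⟨rfl, h⟩))
        · exact Or.inr (Or.inr ⟨c :: z, c', d', x', y', hne, rfl, rfl⟩)
      · exact Or.inr (Or.inr ⟨[], c, d, x, y, h, rfl, rfl⟩)

theorem _root_.List.suffix_or_suffix_or_exists_ne {α : Type*} (x y : List α) :
    x <:+ y ∨ y <:+ x ∨ ∃ z c d x' y', c ≠ d ∧ x = x' ++ c :: z ∧ y = y' ++ d :: z := by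
  rcases List.prefix_or_prefix_or_exists_ne x.reverse y.reverse with
    h | h | ⟨z, c, d, x', y', hne, hx, hy⟩
  · exact Or.inl (by simpa using h)
  · exact Or.inr (Or.inl (by simpa using h))
  · refine Or.inr (Or.inr ⟨z.reverse, c, d, x'.reverse, y'.reverse, hne, ?_, ?_⟩)
    · rw [← List.reverse_reverse x, hx]
      simp
    · rw [← List.reverse_reverse y, hy]
      simp

/-- Walks that separate do so by different letters after a common part, so their ends lie on
different sides of the branching point. If one word extends the other, simplicity of the longer one
decides. -/
theorem IsSimple.eq_of_left_eq {x y : List PedigreeStep} (hx : IsSimple e x) (hy : IsSimple e y)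
    (h : (walk e x).left = (walk e y).left) : x = y := by
  rcases List.suffix_or_suffix_or_exists_ne x y with h' | h' | ⟨z, c, d, x', y', hne, rfl, rfl⟩
  · exact hy _ _ h' List.suffix_rfl h
  · exact hx _ _ List.suffix_rfl h' h
  · have h1 := hx.side_eq
    rw [h, hy.side_eq] at h1
    exact absurd h1.symm hne

/-- The step must hit an earlier point of the walk. A point before the final run of `c`-steps is on
the wrong side of the foot of that run, and a point inside the run other than its foot would force
an earlier repetition. -/
theorem turn_walk_of_not_isSimple {c : PedigreeStep} {x : List PedigreeStep}
    (hx : IsSimple e x) (h : ¬ IsSimple e (c :: x)) :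
    Q.turn c (walk e x) = walk e (stripLead c x) := by
  obtain ⟨y, hy, hxy⟩ := hx.exists_of_not_cons h
  obtain ⟨n, hn⟩ := exists_eq_replicate_append_stripLead c x
  have hzx := stripLead_suffix c x
  have hzne := stripLead_ne_cons c x
  generalize stripLead c x = z at hn hzx hzne ⊢
  have hturn : Q.turn c (walk e x) = (Q.turn c ^ (n + 1)) (walk e z) := by
    rw [hn, walk_replicate_append, pow_succ', Equiv.Perm.mul_apply]
  have hsame : (Q.turn c).SameCycle (walk e z) (Q.turn c (walk e x)) := by
    rw [hturn, Equiv.Perm.sameCycle_pow_right]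
  rw [walk_cons] at hxy
  by_cases hyz : z <:+ y
  · have hy' : ∃ i ≤ n, y = List.replicate i c ++ z := by
      have hle := hyz.length_le
      have hle' := hy.length_le
      rw [hn] at hle'
      simp only [List.length_append, List.length_replicate] at hle'
      refine ⟨y.length - z.length, by omega, ?_⟩
      have := List.suffix_iff_eq_drop.1 hy
      rw [hn, List.drop_append_of_le_length (by simp; omega), List.drop_replicate] at this
      rw [this]
      simp
    obtain ⟨i, hi, rfl⟩ := hy'
    have heq : Q.turn c (walk e x) = (Q.turn c ^ i) (walk e z) := by
      rw [walk_replicate_append] at hxy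
      refine eq_of_sameCycle_turn (hsame.symm.trans ?_) hxy
      rw [Equiv.Perm.sameCycle_pow_right]
    rcases Nat.eq_zero_or_pos i with rfl | hi0
    · exact heq
    · exfalso
      -- Cancelling `i` turns shows that the run had already returned to its foot after `n + 1 - i ≤
      -- n` steps, within the simple walk `x`.
      rw [hturn, show n + 1 = i + (n + 1 - i) by omega, pow_add, Equiv.Perm.mul_apply] at heq
      have heq' := (Q.turn c ^ i).injective heq
      rw [← walk_replicate_append] at heq'
      have := hx _ _ ⟨List.replicate (n - (n + 1 - i)) c, by
        rw [← List.append_assoc, ← List.replicate_add, hn]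
        congr 2
        omega⟩ hzx (congrArg Quiver.Total.left heq')
      have := congrArg List.length this
      simp at this
      omega
  · exfalso
    -- Here the repeated point comes before the foot, which was reached by a step `d ≠ c`. Seen from
    -- the foot, earlier points lie on side `d`, while the new point lies on side `c`.
    have hyz' : y <:+ z := (List.suffix_or_suffix_of_suffix hy hzx).resolve_right hyz
    rcases z with _ | ⟨d, z⟩
    · exact hyz (by rw [List.suffix_nil.1 hyz'])
    have hdc : d ≠ c := by
      rintro rfl
      exact hzne z rfl
    have hyz'' : y <:+ z := by
      rcases List.suffix_cons_iff.1 hyz' with rfl | h'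
      · exact absurd List.suffix_rfl hyz
      · exact h'
    have hne : ∀ w, w <:+ z → (walk e w).left ≠ (walk e (d :: z)).left := by
      intro w hw
      refine hx.left_ne ((hw.trans (List.suffix_cons d z)).trans hzx) hzx fun h' => ?_
      have := hw.length_le
      rw [h'] at this
      simp at this
    have h1 : side (walk e (d :: z)) (walk e z).left = d := by
      refine side_of_sameCycle ?_ (hne z List.suffix_rfl)
      rw [walk_cons]
      exact Equiv.Perm.sameCycle_apply_left.2 .rfl
    have h2 : side (walk e (d :: z)) (walk e y).left = c := by
      rw [← hxy]
      refine side_of_sameCycle hsame ?_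
      rw [hxy]
      exact hne y hyz''
    obtain ⟨t, rfl⟩ := hyz''
    rw [side_walk_append] at h1
    · exact hdc (h1.symm.trans h2)
    · intro w hw
      refine hne _ ?_
      obtain ⟨r, rfl⟩ := hw
      exact ⟨r, by simp⟩

/-! ### The pedigree of a Brauer-quiver -/

variable (e)

theorem finite_isSimple : {x | IsSimple e x}.Finite := by
  refine Set.Finite.of_finite_image (f := fun x => (walk e x).left) (Set.toFinite _) ?_
  intro x hx y hy h
  exact IsSimple.eq_of_left_eq hx hy h

/-- The pedigree formed by the simple walks that start with `e`. -/
def pedigree : Pedigree where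
  points := (finite_isSimple e).toFinset
  root_mem := (finite_isSimple e).mem_toFinset.2 isSimple_nil
  parent_mem s x h := (finite_isSimple e).mem_toFinset.2
    (((finite_isSimple e).mem_toFinset.1 h).of_suffix (List.suffix_cons s x))

variable {e}

theorem mem_pedigree {x : List PedigreeStep} : x ∈ (pedigree e).points ↔ IsSimple e x :=
  (finite_isSimple e).mem_toFinset

theorem walk_climb (c : PedigreeStep) (x : (pedigree e).Point) :
    walk e ((pedigree e).climb c x).1 = Q.turn c (walk e x.1) := by
  by_cases h : c :: x.1 ∈ (pedigree e).points
  · rw [Pedigree.climb_of_mem h, walk_cons]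
  · rw [Pedigree.climb_of_notMem h,
      turn_walk_of_not_isSimple (mem_pedigree.1 x.2) (fun h' => h (mem_pedigree.2 h'))]

variable (e) in
/-- The arrow of kind `c` starting in the end point of a simple walk. -/
def pedigreeArrow : PedigreeStep → (pedigree e).Point → Quiver.Total Q.Point
  | .alpha, x => walk e x.1
  | .betaInv, x => otherArrow (walk e x.1)

theorem pedigreeArrow_left (c : PedigreeStep) (x : (pedigree e).Point) :
    (pedigreeArrow e c x).left = (walk e x.1).left := by
  cases c
  · rfl
  · exact otherArrow_left _

theorem nextArrow_pedigreeArrow (c : PedigreeStep) (x : (pedigree e).Point) :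
    Q.nextArrow (pedigreeArrow e c x) = pedigreeArrow e c ((pedigree e).next c x) := by
  cases c
  · exact (walk_climb .alpha x).symm
  · have h := walk_climb .betaInv ((pedigree e).next .betaInv x)
    rw [Pedigree.climb_next_betaInv] at h
    change Q.nextArrow (otherArrow (walk e x.1)) = otherArrow (walk e _)
    rw [h, nextArrow_other_turn]

theorem exists_pedigreeArrow_eq {a : Quiver.Total Q.Point} {x : (pedigree e).Point}
    (h : a.left = (walk e x.1).left) : ∃ c, pedigreeArrow e c x = a := by
  rcases eq_or_eq_otherArrow h with rfl | rfl
  · exact ⟨.alpha, rfl⟩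
  · exact ⟨.betaInv, rfl⟩

/-- The end points of simple walks are closed under following arrows in both directions, because
`next` permutes the points of the pedigree; connectedness does the rest. -/
theorem exists_walk_left_eq (y : Q.Point) : ∃ x : (pedigree e).Point, (walk e x.1).left = y := by
  have hstep : ∀ a : Quiver.Total Q.Point,
      (∃ x : (pedigree e).Point, (walk e x.1).left = a.left) ↔
        ∃ x : (pedigree e).Point, (walk e x.1).left = a.right := by
    intro a
    constructor
    · rintro ⟨x, hx⟩
      obtain ⟨c, rfl⟩ := exists_pedigreeArrow_eq hx.symm
      exact ⟨(pedigree e).next c x, by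
        rw [← nextArrow_left, nextArrow_pedigreeArrow, pedigreeArrow_left]⟩
    · rintro ⟨x, hx⟩
      rw [← nextArrow_left] at hx
      obtain ⟨c, hc⟩ := exists_pedigreeArrow_eq hx.symm
      obtain ⟨z, rfl⟩ := ((pedigree e).next c).surjective x
      rw [← nextArrow_pedigreeArrow] at hc
      exact ⟨z, by rw [← Q.nextArrow.injective hc, pedigreeArrow_left]⟩
  have key : ∀ x y : Q.Point, Relation.EqvGen (fun a b => Nonempty (a ⟶ b)) x y →
      ((∃ z : (pedigree e).Point, (walk e z.1).left = x) ↔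
        ∃ z : (pedigree e).Point, (walk e z.1).left = y) := by
    intro x y h
    induction h with
    | rel x y h =>
      obtain ⟨r⟩ := h
      exact hstep ⟨x, y, r⟩
    | refl x => rfl
    | symm x y _ ih => exact ih.symm
    | trans x y z _ _ ih ih' => exact ih.trans ih'
  exact (key e.left y (Q.connected _ _)).1 ⟨⟨[], (pedigree e).root_mem⟩, rfl⟩

theorem walk_left_bijective :
    Function.Bijective fun x : (pedigree e).Point => (walk e x.1).left :=
  ⟨fun x y h => Subtype.ext ((mem_pedigree.1 x.2).eq_of_left_eq (mem_pedigree.1 y.2) h),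
    exists_walk_left_eq⟩

theorem pedigreeArrow_bijective :
    Function.Bijective fun p : PedigreeStep × (pedigree e).Point => pedigreeArrow e p.1 p.2 := by
  constructor
  · rintro ⟨c, x⟩ ⟨d, y⟩ h
    have hxy : x = y := by
      refine walk_left_bijective.1 ?_
      have := congrArg Quiver.Total.left h
      simpa only [pedigreeArrow_left] using this
    subst hxy
    cases c <;> cases d
    · rfl
    · exact absurd h.symm (otherArrow_ne _)
    · exact absurd h (otherArrow_ne _)
    · rfl
  · intro a
    obtain ⟨x, hx⟩ := exists_walk_left_eq (e := e) a.left
    obtain ⟨c, hc⟩ := exists_pedigreeArrow_eq hx.symm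
    exact ⟨(c, x), hc⟩

variable (e) in
/-- The pedigree of a Brauer-quiver describes it. -/
def pedigreeModel : PedigreeModel (pedigree e) Q.Point where
  point := Equiv.ofBijective _ walk_left_bijective
  arrow := Equiv.ofBijective _ pedigreeArrow_bijective
  left c x := pedigreeArrow_left c x
  right c x := by
    change (pedigreeArrow e c x).right = (walk e ((pedigree e).next c x).1).left
    rw [← nextArrow_left, nextArrow_pedigreeArrow, pedigreeArrow_left]
  closed Z hZ c x h := by
    change pedigreeArrow e c _ ∈ Z
    rw [← nextArrow_pedigreeArrow]
    exact nextArrow_mem hZ h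

variable (Q) in
theorem nonempty_arrow : Nonempty (Quiver.Total Q.Point) := by
  obtain ⟨x⟩ := Q.nonempty
  obtain ⟨Z, Z', -, h⟩ := Set.ncard_eq_two.1 (Q.two_cycles x)
  have hZ := (Set.ext_iff.1 h Z).2 (Or.inl rfl)
  obtain ⟨a, -, -⟩ := Cycle.mem_map.1 hZ.2
  exact ⟨a⟩

end BrauerQuiver

end

theorem theorem17 (k : Type w) [Field k] :
    (∀ L : Pedigree, ∃ Q : BrauerQuiver.{0, 0},
      Nonempty (TrivialExtension k (L.algebra k) ≃ₐ[k] Q.algebra k)) ∧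
    (∀ Q : BrauerQuiver.{u, v}, ∃ L : Pedigree,
      Nonempty (Q.algebra k ≃ₐ[k] TrivialExtension k (L.algebra k))) := by
  refine ⟨fun L => ⟨L.brauerQuiver, ⟨(L.brauerQuiverModel.algEquiv k).symm⟩⟩, fun Q => ?_⟩
  -- Any arrow may serve as the `α`-arrow at the root; this choice fixes the kinds of all others.
  obtain ⟨e⟩ := Q.nonempty_arrow
  exact ⟨BrauerQuiver.pedigree e, ⟨(BrauerQuiver.pedigreeModel e).algEquiv k⟩⟩
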